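/- Let $W_0,W_1$ be commuting isometries on a complex Hilbert space $\mathfrak K$; the pair $\mathbb W=(W_0,W_1)$ is called a *bi-isometry*. A closed subspace $\mathfrak M\subset\mathfrak K$ is *reducing* for $\mathbb W$ if $\mathfrak M$ and $\mathfrak M^\perp$ are invariant for $W_0$ and $W_1$, and $\mathbb W$ is *$\{0\}$-pure* if it has no nonzero reducing subspace $\mathfrak M$ for which $W_0|\mathfrak M$ is unitary. Let $\mathfrak H=\bigoplus_{k\ge0}W_0^k(\mathfrak K\ominus W_0\mathfrak K)$ be the space of the shift part of the von Neumann–Wold decomposition of $W_0$, and put $V_0=W_0|\mathfrak H$, $A=P_{\mathfrak H}W_1|\mathfrak H$ and $\mathfrak E=\mathfrak H\ominus V_0\mathfrak H$. The *characteristic function* of $\mathbb W$ is the $\mathcal L(\mathfrak E)$-valued function $$\Theta_{\mathbb W}(z)=P_{\mathfrak E}(I-zV_0^*)^{-1}A|\mathfrak E,\qquad z\in\mathbb D=\{z\in\mathbb C:|z|<1\}.$$ Two bi-isometries $\mathbb W,\mathbb W'$ are *unitarily equivalent* if there is a unitary operator $U$ with $UW_i=W_i'U$ for $i=0,1$. Two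 functions $\Theta:\mathbb D\to\mathcal L(\mathfrak E)$ and $\Theta':\mathbb D\to\mathcal L(\mathfrak E')$ are *unitarily equivalent* if there is a unitary operator $U:\mathfrak E\to\mathfrak E'$ with $U\Theta(z)=\Theta'(z)U$ for all $z\in\mathbb D$. Let $\mathbb W$ and $\mathbb W'$ be bi-isometries on complex Hilbert spaces $\mathfrak K$ and $\mathfrak K'$, with characteristic functions $\Theta:\mathbb D\to\mathcal L(\mathfrak E)$ and $\Theta':\mathbb D\to\mathcal L(\mathfrak E')$. 1. The characteristic function of $\mathbb W\oplus\mathbb W'=(W_0\oplus W_0',W_1\oplus W_1')$ is $z\mapsto\Theta(z)\oplus\Theta'(z)$, $z\in\mathbb D$, where the space on which it acts is identified with $\mathfrak E\oplus\mathfrak E'$ as a subspace of $\mathfrak K\oplus\mathfrak K'$. 2. If $\mathbb W$ is unitarily equivalent to $\mathbb W'$, then $\Theta$ is unitarily equivalent to $\Theta'$. 3. If $\mathbb W$ and $\mathbb W'$ are $\{0\}$-pure and $\Theta$ is unitarily equivalent to $\Theta'$, then $\mathbb W$ is unitarily equivalent to $\mathbb W'$. 4. For every complex Hilbert space $\mathfrak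 F$ and every analytic function $\Theta:\mathbb D\to\mathcal L(\mathfrak F)$ with $\|\Theta(z)\|\le1$ for all $z\in\mathbb D$, there is a $\{0\}$-pure bi-isometry whose characteristic function is unitarily equivalent to $\Theta$. -/

import Mathlib

universe u v w

noncomputable section

/-- A bi-isometry: an ordered pair of commuting isometries on a Hilbert space. -/
structure BiIsometry (K : Type u) [NormedAddCommGroup K] [InnerProductSpace ℂ K] where
  /-- the first isometry -/
  W₀ : K →ₗᵢ[ℂ] K
  /-- the second isometry -/
  W₁ : K →ₗᵢ[ℂ] K
  comm : ∀ x, W₀ (W₁ x) = W₁ (W₀ x)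

/-- The orthogonal direct sum `T ⊕ T'` of two isometries, on the Hilbert space direct sum. -/
def isometryDirectSum {K : Type u} {K' : Type v}
    [NormedAddCommGroup K] [InnerProductSpace ℂ K]
    [NormedAddCommGroup K'] [InnerProductSpace ℂ K']
    (T : K →ₗᵢ[ℂ] K) (T' : K' →ₗᵢ[ℂ] K') :
    WithLp 2 (K × K') →ₗᵢ[ℂ] WithLp 2 (K × K') where
  toFun x := WithLp.toLp 2 (T x.fst, T' x.snd)
  map_add' x y := by apply (WithLp.equiv 2 _).injective; ext <;> simp
  map_smul' c x := by apply (WithLp.equiv 2 _).injective; ext <;> simp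
  norm_map' x := by simp [WithLp.prod_norm_eq_of_L2]

section FunctionOfPair

variable {H : Type u} [NormedAddCommGroup H] [InnerProductSpace ℂ H]

/-- The subspace `𝔈 = ℌ ⊖ V ℌ` (which equals `ker V*`). -/
def defectSpace (V : H →L[ℂ] H) : Submodule ℂ H :=
  (LinearMap.range (V : H →ₗ[ℂ] H))ᗮ

variable [CompleteSpace H]

/-- The operator function of a pair `(V, A)`: the operator `P_𝔈 (I - z V*)⁻¹ A | 𝔈` on
`𝔈 = ℌ ⊖ V ℌ`. For `‖V‖ ≤ 1` and `‖z‖ < 1` the operator `I - z V*` is invertible, so that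
`Ring.inverse` is its inverse. Only the values with `‖z‖ < 1` are ever used. -/
def pairFunction (V A : H →L[ℂ] H) (z : ℂ) : defectSpace V →L[ℂ] defectSpace V :=
  haveI : CompleteSpace (defectSpace V) := Submodule.instOrthogonalCompleteSpace _
  (defectSpace V).orthogonalProjectionOnto ∘L Ring.inverse (1 - z • ContinuousLinearMap.adjoint V) ∘L A ∘L
    (defectSpace V).subtypeL

end FunctionOfPair

namespace BiIsometry

section Basic

variable {K : Type u} [NormedAddCommGroup K] [InnerProductSpace ℂ K]

/-- `M` is a reducing (closed) subspace for the pair: `M` and its orthogonal complement are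
invariant for both isometries. -/
structure IsReducing (W : BiIsometry K) (M : Submodule ℂ K) : Prop where
  isClosed : IsClosed (M : Set K)
  inv₀ : ∀ x ∈ M, W.W₀ x ∈ M
  inv₁ : ∀ x ∈ M, W.W₁ x ∈ M
  orth_inv₀ : ∀ x ∈ Mᗮ, W.W₀ x ∈ Mᗮ
  orth_inv₁ : ∀ x ∈ Mᗮ, W.W₁ x ∈ Mᗮ

/-- `{0}`-purity: there is no nonzero reducing subspace `M` for which `W₀ | M` is unitary.
As `W₀ | M` is an isometry of `M` into `M`, it is unitary when it maps `M` onto `M`. -/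
def IsZeroPure (W : BiIsometry K) : Prop :=
  ∀ M : Submodule ℂ K, W.IsReducing M → (∀ y ∈ M, ∃ x ∈ M, W.W₀ x = y) → M = ⊥

/-- Unitary equivalence: one unitary operator conjugates both isometries. -/
def UnitarilyEquivalent {K' : Type v} [NormedAddCommGroup K'] [InnerProductSpace ℂ K']
    (W : BiIsometry K) (W' : BiIsometry K') : Prop :=
  ∃ U : K ≃ₗᵢ[ℂ] K', (∀ x, U (W.W₀ x) = W'.W₀ (U x)) ∧ ∀ x, U (W.W₁ x) = W'.W₁ (U x)

/-- The direct sum `(W₀ ⊕ W₀', W₁ ⊕ W₁')`. -/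
def directSum {K' : Type v} [NormedAddCommGroup K'] [InnerProductSpace ℂ K']
    (W : BiIsometry K) (W' : BiIsometry K') : BiIsometry (WithLp 2 (K × K')) where
  W₀ := isometryDirectSum W.W₀ W'.W₀
  W₁ := isometryDirectSum W.W₁ W'.W₁
  comm x := by
    apply (WithLp.equiv 2 _).injective
    ext <;> simp [isometryDirectSum, W.comm, W'.comm]

/-- The space of the shift part in the von Neumann-Wold decomposition of `W₀`: the closed
linear span of the subspaces `W₀ᵏ (𝔎 ⊖ W₀ 𝔎)`, `k ≥ 0`. -/
def shiftSpace (W : BiIsometry K) : Submodule ℂ K :=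
  (⨆ k : ℕ, (defectSpace W.W₀.toContinuousLinearMap).map (W.W₀.toLinearMap ^ k)).topologicalClosure

theorem map_mem_shiftSpace (W : BiIsometry K) (x : K) (hx : x ∈ W.shiftSpace) :
    W.W₀ x ∈ W.shiftSpace := by
  have h : (⨆ k : ℕ, (defectSpace W.W₀.toContinuousLinearMap).map
      (W.W₀.toLinearMap ^ k)) ≤ W.shiftSpace.comap W.W₀.toLinearMap := by
    refine iSup_le fun k => ?_
    rintro _ ⟨y, hy, rfl⟩
    refine Submodule.le_topologicalClosure _ (Submodule.mem_iSup_of_mem (k + 1) ⟨y, hy, ?_⟩)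
    rw [pow_succ']
    rfl
  have hcl : IsClosed (W.shiftSpace.comap W.W₀.toLinearMap : Set K) :=
    (Submodule.isClosed_topologicalClosure _).preimage W.W₀.continuous
  exact Submodule.topologicalClosure_minimal _ h hcl hx

/-- The unilateral shift `V₀ = W₀ | ℌ`, first entry of the characteristic pair. -/
def charShift (W : BiIsometry K) : W.shiftSpace →L[ℂ] W.shiftSpace :=
  (W.W₀.toContinuousLinearMap ∘L W.shiftSpace.subtypeL).codRestrict W.shiftSpace
    fun x => W.map_mem_shiftSpace x x.2

/-- The space `𝔈 = ℌ ⊖ V₀ ℌ` on which the characteristic function acts. -/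
abbrev charSpace (W : BiIsometry K) : Submodule ℂ W.shiftSpace :=
  defectSpace W.charShift

end Basic

variable {K : Type u} [NormedAddCommGroup K] [InnerProductSpace ℂ K] [CompleteSpace K]

instance (W : BiIsometry K) : CompleteSpace W.shiftSpace :=
  (Submodule.isClosed_topologicalClosure _).completeSpace_coe

/-- The contraction `A = P_ℌ W₁ | ℌ`, second entry of the characteristic pair. -/
def charContraction (W : BiIsometry K) : W.shiftSpace →L[ℂ] W.shiftSpace :=
  W.shiftSpace.orthogonalProjectionOnto ∘L W.W₁.toContinuousLinearMap ∘L W.shiftSpace.subtypeL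

/-- The characteristic function of a bi-isometry. -/
def charFunction (W : BiIsometry K) (z : ℂ) : W.charSpace →L[ℂ] W.charSpace :=
  pairFunction W.charShift W.charContraction z

end BiIsometry

section OperatorFunctions

variable {E : Type u} [NormedAddCommGroup E] [InnerProductSpace ℂ E]

/-- `Θ`, restricted to the open unit disk, is a contractive analytic function. -/
structure IsContractiveAnalytic (Θ : ℂ → E →L[ℂ] E) : Prop where
  analytic : AnalyticOnNhd ℂ Θ (Metric.ball 0 1)
  contractive : ∀ z ∈ Metric.ball (0 : ℂ) 1, ‖Θ z‖ ≤ 1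

/-- Unitary equivalence on the disk: `U Θ(z) = Θ'(z) U`, `|z| < 1`, for some unitary `U`. -/
def FunctionsUnitarilyEquivalent {E' : Type v} [NormedAddCommGroup E'] [InnerProductSpace ℂ E']
    (Θ : ℂ → E →L[ℂ] E) (Θ' : ℂ → E' →L[ℂ] E') : Prop :=
  ∃ U : E ≃ₗᵢ[ℂ] E', ∀ z ∈ Metric.ball (0 : ℂ) 1, ∀ x, U (Θ z x) = Θ' z (U x)

end OperatorFunctions

end

/-!
Write `V` and `A` for the operators `V₀` and `A` of the characteristic pair. The Taylor
coefficients of `⟪f, Θ(z) e⟫` are the numbers `⟪Vᵏ f, A e⟫`. As `V` is a unilateral shift and `A`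
commutes with `V`, they determine the pair `(V, A)` up to unitary equivalence. A `{0}`-pure `𝕎`
is generated by `ℌ` together with the vectors `W₀*ⁿ W₁ᵐ (W₁ h - A h)` of `ℌᗮ`, `h ∈ ℌ`; their
inner products can be written in terms of `(V, A)`, so that pair determines `𝕎`.

To realize `Θ`, let it act on `ℓ²(𝔉)` as an analytic Toeplitz operator `A`. It is contractive, by
Parseval's identity on roots of unity applied to truncations of the power series, and it commutes
with the shift `V`. With `D = (1 - A* A)^{1/2}`, the dilation
`(h, r₀, r₁, …) ↦ (A h, D h, r₀, …)` is isometric. Since `‖D V h‖ = ‖D h‖`, the map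
`D h ↦ D V h` extends to a unitary operator, which acts on all entries `rₙ` at once and thereby
extends `V` to an isometry commuting with the dilation. Restricting to the least
reducing subspace that contains `ℌ` keeps `Θ` and makes the pair `{0}`-pure.
-/

noncomputable section

open scoped InnerProductSpace InnerProduct

local notation:max V:max "†ᵢ" => (LinearIsometry.toContinuousLinearMap V)†

section PairFunction

variable {H : Type*} [NormedAddCommGroup H] [InnerProductSpace ℂ H]
  {H' : Type*} [NormedAddCommGroup H'] [InnerProductSpace ℂ H']

theorem mem_defectSpace_iff {V : H →L[ℂ] H} {e : H} :
    e ∈ defectSpace V ↔ ∀ x, ⟪V x, e⟫_ℂ = 0 := by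
  simp [defectSpace, Submodule.mem_orthogonal]

/-- The wandering subspace `H ⊖ V H` of an isometry `V`. -/
abbrev wanderingSpace (V : H →ₗᵢ[ℂ] H) : Submodule ℂ H :=
  defectSpace V.toContinuousLinearMap

theorem inner_iterate_iterate_wanderingSpace (V : H →ₗᵢ[ℂ] H) (k l : ℕ) (e f : wanderingSpace V) :
    ⟪V^[k] e, V^[l] f⟫_ℂ = if k = l then ⟪e, f⟫_ℂ else 0 := by
  induction k generalizing l with
  | zero =>
    cases l with
    | zero => simp
    | succ l =>
      rw [Function.iterate_succ_apply']
      exact inner_eq_zero_symm.1 (mem_defectSpace_iff.1 e.2 (V^[l] f))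
  | succ k ih =>
    cases l with
    | zero => simpa [Function.iterate_succ_apply'] using mem_defectSpace_iff.1 f.2 (V^[k] e)
    | succ l => simp [Function.iterate_succ_apply', ih]

variable [CompleteSpace H] [CompleteSpace H']

instance completeSpace_defectSpace (V : H →L[ℂ] H) : CompleteSpace (defectSpace V) :=
  Submodule.instOrthogonalCompleteSpace _

theorem mem_defectSpace_iff_adjoint_eq_zero {V : H →L[ℂ] H} {e : H} :
    e ∈ defectSpace V ↔ (V†) e = 0 := by
  rw [defectSpace, ContinuousLinearMap.orthogonal_range]
  rfl

theorem adjoint_isometry_apply (V : H →ₗᵢ[ℂ] H) (x : H) : V†ᵢ (V x) = x :=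
  DFunLike.congr_fun V.adjoint_comp_self x

theorem orthogonal_wanderingSpace (V : H →ₗᵢ[ℂ] H) :
    (wanderingSpace V)ᗮ = LinearMap.range V.toLinearMap := by
  have hV : IsClosed (LinearMap.range V.toLinearMap : Set H) := by
    rw [LinearMap.coe_range]
    exact V.isometry.isClosedEmbedding.isClosed_range
  exact (Submodule.orthogonal_orthogonal_eq_closure _).trans hV.submodule_topologicalClosure_eq

theorem norm_smul_adjoint_lt_one (V : H →ₗᵢ[ℂ] H) {z : ℂ} (hz : ‖z‖ < 1) : ‖z • V†ᵢ‖ < 1 := by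
  rw [norm_smul, LinearIsometryEquiv.norm_map]
  nlinarith [norm_nonneg z, V.norm_toContinuousLinearMap_le]

theorem isUnit_one_sub_smul_adjoint (V : H →ₗᵢ[ℂ] H) {z : ℂ} (hz : ‖z‖ < 1) :
    IsUnit (1 - z • V†ᵢ) :=
  isUnit_one_sub_of_norm_lt_one (norm_smul_adjoint_lt_one V hz)

theorem inner_pairFunction (V A : H →L[ℂ] H) (z : ℂ) (e f : defectSpace V) :
    ⟪f, pairFunction V A z e⟫_ℂ = ⟪(f : H), Ring.inverse (1 - z • V†) (A e)⟫_ℂ :=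
  Submodule.inner_orthogonalProjectionOnto_eq_of_mem_left f _

theorem coe_pairFunction (V : H →ₗᵢ[ℂ] H) (A : H →L[ℂ] H) (z : ℂ) (e : wanderingSpace V) :
    (pairFunction V.toContinuousLinearMap A z e : H) =
      Ring.inverse (1 - z • V†ᵢ) (A e) -
        V (V†ᵢ (Ring.inverse (1 - z • V†ᵢ) (A e))) := by
  set y := Ring.inverse (1 - z • V†ᵢ) (A e)
  refine (wanderingSpace V).eq_starProjection_of_mem_orthogonal (u := y) ?_ ?_
  · rw [mem_defectSpace_iff_adjoint_eq_zero, map_sub, adjoint_isometry_apply, sub_self]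
  · rw [sub_sub_cancel, orthogonal_wanderingSpace]
    exact ⟨_, rfl⟩

theorem hasSum_inner_pairFunction (V : H →ₗᵢ[ℂ] H) (A : H →L[ℂ] H) {z : ℂ} (hz : ‖z‖ < 1)
    (e f : wanderingSpace V) :
    HasSum (fun k : ℕ => z ^ k • ⟪V^[k] f, A e⟫_ℂ)
      ⟪f, pairFunction V.toContinuousLinearMap A z e⟫_ℂ := by
  have h := (hasSum_geom_series_inverse _ (norm_smul_adjoint_lt_one V hz)).mapL
    (innerSL ℂ (f : H) ∘L ContinuousLinearMap.apply ℂ H (A e))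
  rw [inner_pairFunction]
  refine h.congr_fun fun k => ?_
  have hadj : V†ᵢ ^ k = (V.toContinuousLinearMap ^ k)† := by
    simp only [← ContinuousLinearMap.star_eq_adjoint, star_pow]
  simp [smul_pow, hadj, ContinuousLinearMap.adjoint_inner_right]

end PairFunction

section Intertwining

variable {H : Type*} [NormedAddCommGroup H] [InnerProductSpace ℂ H] [CompleteSpace H]
  {H' : Type*} [NormedAddCommGroup H'] [InnerProductSpace ℂ H'] [CompleteSpace H']
  {V : H →ₗᵢ[ℂ] H} {A : H →L[ℂ] H} {V' : H' →ₗᵢ[ℂ] H'} {A' : H' →L[ℂ] H'} {T : H →L[ℂ] H'}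

theorem map_adjoint_of_intertwine (hTV : ∀ x, T (V x) = V' (T x))
    (hTE : ∀ e ∈ wanderingSpace V, T e ∈ wanderingSpace V') (x : H) :
    T (V†ᵢ x) = V'†ᵢ (T x) := by
  have hx : x - V (V†ᵢ x) ∈ wanderingSpace V := by
    rw [mem_defectSpace_iff_adjoint_eq_zero, map_sub, adjoint_isometry_apply, sub_self]
  have h := mem_defectSpace_iff_adjoint_eq_zero.1 (hTE _ hx)
  rw [map_sub, map_sub, hTV, adjoint_isometry_apply, sub_eq_zero] at h
  exact h.symm

theorem map_inverse_one_sub_of_intertwine (hTV : ∀ x, T (V x) = V' (T x))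
    (hTE : ∀ e ∈ wanderingSpace V, T e ∈ wanderingSpace V') {z : ℂ} (hz : ‖z‖ < 1) (x : H) :
    T (Ring.inverse (1 - z • V†ᵢ) x) = Ring.inverse (1 - z • V'†ᵢ) (T x) := by
  set y := Ring.inverse (1 - z • V†ᵢ) x
  have hy : (1 - z • V†ᵢ) y = x :=
    DFunLike.congr_fun (Ring.mul_inverse_cancel _ (isUnit_one_sub_smul_adjoint V hz)) x
  have hTy : T x = (1 - z • V'†ᵢ) (T y) := by
    simp [← hy, map_adjoint_of_intertwine hTV hTE]
  rw [hTy]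
  exact (DFunLike.congr_fun (Ring.inverse_mul_cancel _ (isUnit_one_sub_smul_adjoint V' hz))
    (T y)).symm

theorem coe_pairFunction_of_intertwine (hTV : ∀ x, T (V x) = V' (T x))
    (hTA : ∀ x, T (A x) = A' (T x)) (hTE : ∀ e ∈ wanderingSpace V, T e ∈ wanderingSpace V')
    {z : ℂ} (hz : ‖z‖ < 1) {e : wanderingSpace V} {e' : wanderingSpace V'} (he : (e' : H') = T e) :
    (pairFunction V'.toContinuousLinearMap A' z e' : H') =
      T (pairFunction V.toContinuousLinearMap A z e) := by
  rw [coe_pairFunction, coe_pairFunction, map_sub, hTV, map_adjoint_of_intertwine hTV hTE,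
    map_inverse_one_sub_of_intertwine hTV hTE hz, hTA, he]

theorem functionsUnitarilyEquivalent_of_intertwine (hTV : ∀ x, T (V x) = V' (T x))
    (hTA : ∀ x, T (A x) = A' (T x)) (hTE : ∀ e ∈ wanderingSpace V, T e ∈ wanderingSpace V')
    (hT : ∀ e ∈ wanderingSpace V, ‖T e‖ = ‖e‖)
    (hT' : ∀ e' ∈ wanderingSpace V', ∃ e ∈ wanderingSpace V, T e = e') :
    FunctionsUnitarilyEquivalent (pairFunction V.toContinuousLinearMap A)
      (pairFunction V'.toContinuousLinearMap A') := by
  let L : wanderingSpace V →ₗᵢ[ℂ] wanderingSpace V' :=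
    ⟨(T : H →ₗ[ℂ] H').restrict hTE, fun e => hT e e.2⟩
  have hL : Function.Surjective L := fun e' => by
    obtain ⟨e, he, hTe⟩ := hT' e' e'.2
    exact ⟨⟨e, he⟩, Subtype.ext hTe⟩
  refine ⟨.ofSurjective L hL, fun z hz e => Subtype.ext ?_⟩
  exact (coe_pairFunction_of_intertwine hTV hTA hTE (mem_ball_zero_iff.1 hz) rfl).symm

end Intertwining

namespace FunctionsUnitarilyEquivalent

variable {E E' E'' : Type*} [NormedAddCommGroup E] [InnerProductSpace ℂ E]
  [NormedAddCommGroup E'] [InnerProductSpace ℂ E'] [NormedAddCommGroup E'']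
  [InnerProductSpace ℂ E''] {Θ : ℂ → E →L[ℂ] E} {Θ' : ℂ → E' →L[ℂ] E'} {Θ'' : ℂ → E'' →L[ℂ] E''}

theorem symm (h : FunctionsUnitarilyEquivalent Θ Θ') : FunctionsUnitarilyEquivalent Θ' Θ := by
  obtain ⟨U, hU⟩ := h
  refine ⟨U.symm, fun z hz x => ?_⟩
  rw [U.symm_apply_eq, hU z hz, U.apply_symm_apply]

theorem trans (h : FunctionsUnitarilyEquivalent Θ Θ') (h' : FunctionsUnitarilyEquivalent Θ' Θ'') :
    FunctionsUnitarilyEquivalent Θ Θ'' := by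
  obtain ⟨U, hU⟩ := h
  obtain ⟨U', hU'⟩ := h'
  exact ⟨U.trans U', fun z hz x => (congrArg U' (hU z hz x)).trans (hU' z hz _)⟩

end FunctionsUnitarilyEquivalent

section Gram

variable {E : Type*} [NormedAddCommGroup E] [InnerProductSpace ℂ E]
  {E' : Type*} [NormedAddCommGroup E'] [InnerProductSpace ℂ E'] {ι : Type*} {x : ι → E} {y : ι → E'}

theorem denseRange_linearCombination (hx : Dense (Submodule.span ℂ (Set.range x) : Set E)) :
    DenseRange (Finsupp.linearCombination ℂ x) := by
  rwa [← Finsupp.range_linearCombination, LinearMap.coe_range] at hx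

theorem norm_linearCombination_eq_of_gram_eq (hxy : ∀ i j, ⟪x i, x j⟫_ℂ = ⟪y i, y j⟫_ℂ)
    (c : ι →₀ ℂ) : ‖Finsupp.linearCombination ℂ y c‖ = ‖Finsupp.linearCombination ℂ x c‖ := by
  rw [norm_eq_sqrt_re_inner (𝕜 := ℂ), norm_eq_sqrt_re_inner (𝕜 := ℂ)]
  simp only [Finsupp.linearCombination_apply, Finsupp.sum, sum_inner, inner_sum, inner_smul_left,
    inner_smul_right, hxy]

theorem exists_unitary_of_gram_eq [CompleteSpace E] [CompleteSpace E']
    (hxy : ∀ i j, ⟪x i, x j⟫_ℂ = ⟪y i, y j⟫_ℂ)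
    (hx : Dense (Submodule.span ℂ (Set.range x) : Set E))
    (hy : Dense (Submodule.span ℂ (Set.range y) : Set E')) :
    ∃ U : E ≃ₗᵢ[ℂ] E', ∀ i, U (x i) = y i := by
  have hx' := denseRange_linearCombination hx
  have hy' := denseRange_linearCombination hy
  have hn := norm_linearCombination_eq_of_gram_eq hxy
  refine ⟨(LinearEquiv.refl ℂ (ι →₀ ℂ)).extendOfIsometry _ _ hx' hy' hn, fun i => ?_⟩
  simpa using LinearEquiv.extendOfIsometry_eq (LinearEquiv.refl ℂ (ι →₀ ℂ)) _ _ hx' hy' hn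
    (Finsupp.single i 1)

theorem intertwine_of_dense_span {U : E →L[ℂ] E'} {T : E →L[ℂ] E} {T' : E' →L[ℂ] E'}
    (hx : Dense (Submodule.span ℂ (Set.range x) : Set E)) (h : ∀ i, U (T (x i)) = T' (U (x i)))
    (v : E) : U (T v) = T' (U v) :=
  DFunLike.congr_fun (ContinuousLinearMap.ext_on (f := U ∘L T) (g := T' ∘L U) hx
    (Set.forall_mem_range.2 h)) v

theorem eq_of_inner_eq_of_dense_span (hx : Dense (Submodule.span ℂ (Set.range x) : Set E))
    {v w : E} (h : ∀ i, ⟪x i, v⟫_ℂ = ⟪x i, w⟫_ℂ) : v = w := by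
  have hvw : innerSL ℂ v = innerSL ℂ w := ContinuousLinearMap.ext_on hx <|
    Set.forall_mem_range.2 fun i => by
      simp only [innerSL_apply_apply]
      rw [← inner_conj_symm, h, inner_conj_symm]
  exact ext_inner_right ℂ (DFunLike.congr_fun hvw)

end Gram

theorem coeff_unique_of_hasSum {E : Type*} [NormedAddCommGroup E] [NormedSpace ℂ E]
    {c d : ℕ → E} {f : ℂ → E} (hc : ∀ z : ℂ, ‖z‖ < 1 → HasSum (fun k => z ^ k • c k) (f z))
    (hd : ∀ z : ℂ, ‖z‖ < 1 → HasSum (fun k => z ^ k • d k) (f z)) : c = d := by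
  let p (c : ℕ → E) : FormalMultilinearSeries ℂ ℂ E :=
    fun n => ContinuousMultilinearMap.mkPiRing ℂ (Fin n) (c n)
  have hp (c : ℕ → E) (n : ℕ) : (p c).coeff n = c n := by
    simp [p, FormalMultilinearSeries.coeff]
  have key (c : ℕ → E) (hc : ∀ z : ℂ, ‖z‖ < 1 → HasSum (fun k => z ^ k • c k) (f z)) :
      HasFPowerSeriesAt f (p c) 0 := by
    refine hasFPowerSeriesAt_iff.2 ?_
    filter_upwards [Metric.ball_mem_nhds (0 : ℂ) one_pos] with z hz
    simpa only [hp, zero_add] using hc z (mem_ball_zero_iff.1 hz)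
  funext n
  rw [← hp c, (key c hc).eq_formalMultilinearSeries (key d hd), hp d]

section UnilateralShift

variable {H : Type*} [NormedAddCommGroup H] [InnerProductSpace ℂ H]
  {H' : Type*} [NormedAddCommGroup H'] [InnerProductSpace ℂ H']

/-- An isometry is a unilateral shift (a pure isometry) when the vectors `Vᵏ e`, with `e` in its
wandering subspace, span a dense subspace. -/
def IsUnilateralShift (V : H →ₗᵢ[ℂ] H) : Prop :=
  Dense (Submodule.span ℂ (Set.range fun i : ℕ × wanderingSpace V => V^[i.1] i.2) : Set H)

variable [CompleteSpace H] [CompleteSpace H']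
  {V : H →ₗᵢ[ℂ] H} {A : H →L[ℂ] H} {V' : H' →ₗᵢ[ℂ] H'} {A' : H' →L[ℂ] H'}

theorem IsUnilateralShift.exists_unitary (hV : IsUnilateralShift V) (hV' : IsUnilateralShift V')
    (u : wanderingSpace V ≃ₗᵢ[ℂ] wanderingSpace V') :
    ∃ Φ : H ≃ₗᵢ[ℂ] H', ∀ (k : ℕ) (e : wanderingSpace V), Φ (V^[k] e) = V'^[k] (u e) := by
  have hdense : Dense (Submodule.span ℂ
      (Set.range fun i : ℕ × wanderingSpace V => V'^[i.1] (u i.2)) : Set H') := by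
    have h := (Function.surjective_id.prodMap u.surjective).range_comp
      fun i : ℕ × wanderingSpace V' => V'^[i.1] i.2
    exact h ▸ hV'
  obtain ⟨Φ, hΦ⟩ := exists_unitary_of_gram_eq (fun i j => by
    rw [inner_iterate_iterate_wanderingSpace, inner_iterate_iterate_wanderingSpace,
      u.inner_map_map]) hV hdense
  exact ⟨Φ, fun k e => hΦ (k, e)⟩

theorem inner_iterate_eq_of_equivalent {u : wanderingSpace V ≃ₗᵢ[ℂ] wanderingSpace V'}
    (hu : ∀ z ∈ Metric.ball (0 : ℂ) 1, ∀ e, u (pairFunction V.toContinuousLinearMap A z e) =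
      pairFunction V'.toContinuousLinearMap A' z (u e)) (k : ℕ) (e f : wanderingSpace V) :
    ⟪V^[k] f, A e⟫_ℂ = ⟪V'^[k] (u f), A' (u e)⟫_ℂ := by
  refine congrFun (f := fun k => ⟪V^[k] f, A e⟫_ℂ) (g := fun k => ⟪V'^[k] (u f), A' (u e)⟫_ℂ)
    (coeff_unique_of_hasSum (fun z hz => hasSum_inner_pairFunction V A hz e f)
    fun z hz => ?_) k
  rw [← u.inner_map_map, hu z (mem_ball_zero_iff.2 hz)]
  exact hasSum_inner_pairFunction V' A' hz (u e) (u f)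

theorem IsUnilateralShift.exists_intertwining_unitary (hV : IsUnilateralShift V)
    (hV' : IsUnilateralShift V') (hA : Function.Commute A V) (hA' : Function.Commute A' V')
    (h : FunctionsUnitarilyEquivalent (pairFunction V.toContinuousLinearMap A)
      (pairFunction V'.toContinuousLinearMap A')) :
    ∃ Φ : H ≃ₗᵢ[ℂ] H', Function.Semiconj Φ V V' ∧ Function.Semiconj Φ A A' := by
  obtain ⟨u, hu⟩ := h
  obtain ⟨Φ, hΦ⟩ := hV.exists_unitary hV' u
  have hΦV : Function.Semiconj Φ V V' := by
    refine intertwine_of_dense_span (U := (Φ : H →L[ℂ] H')) (T := V.toContinuousLinearMap)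
      (T' := V'.toContinuousLinearMap) hV fun ⟨k, e⟩ => ?_
    change Φ (V (V^[k] e)) = V' (Φ (V^[k] e))
    rw [← Function.iterate_succ_apply' V, hΦ, hΦ, Function.iterate_succ_apply']
  have hΦe (e : wanderingSpace V) : Φ e = u e := hΦ 0 e
  have hΦA (e : wanderingSpace V) : Φ (A e) = A' (u e) := by
    refine eq_of_inner_eq_of_dense_span hV' fun ⟨k, f'⟩ => ?_
    obtain ⟨f, rfl⟩ := u.surjective f'
    rw [← inner_iterate_eq_of_equivalent hu, ← hΦ, Φ.inner_map_map]
  refine ⟨Φ, hΦV, intertwine_of_dense_span (U := (Φ : H →L[ℂ] H')) hV fun ⟨k, e⟩ => ?_⟩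
  change Φ (A (V^[k] e)) = A' (Φ (V^[k] e))
  rw [hA.iterate_right k, hΦV.iterate_right k, hΦA, hΦV.iterate_right k, hA'.iterate_right k, hΦe]

end UnilateralShift

section Restriction

variable {K : Type*} [NormedAddCommGroup K] [InnerProductSpace ℂ K] {V : K →ₗᵢ[ℂ] K}
  {N : Submodule ℂ K}

/-- The restriction of an isometry to an invariant subspace. -/
def restrictIsometry (V : K →ₗᵢ[ℂ] K) (N : Submodule ℂ K) (hN : ∀ x ∈ N, V x ∈ N) : N →ₗᵢ[ℂ] N :=
  ⟨V.toLinearMap.restrict hN, fun x => V.norm_map x⟩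

theorem coe_iterate_restrictIsometry (hN : ∀ x ∈ N, V x ∈ N) (k : ℕ) (x : N) :
    ((restrictIsometry V N hN)^[k] x : K) = V^[k] x :=
  Function.Semiconj.iterate_right (f := ((↑) : N → K)) (fun _ => rfl) k x

theorem mem_wanderingSpace_restrictIsometry_iff [N.HasOrthogonalProjection]
    (hN : ∀ x ∈ N, V x ∈ N) (hN' : ∀ x ∈ Nᗮ, V x ∈ Nᗮ) {e : N} :
    e ∈ wanderingSpace (restrictIsometry V N hN) ↔ (e : K) ∈ wanderingSpace V := by
  rw [mem_defectSpace_iff, mem_defectSpace_iff]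
  refine ⟨fun h y => ?_, fun h y => h y⟩
  obtain ⟨a, ha, b, hb, rfl⟩ := N.exists_add_mem_mem_orthogonal y
  have hVb : ⟪V b, (e : K)⟫_ℂ = 0 := Submodule.inner_left_of_mem_orthogonal e.2 (hN' b hb)
  exact (congrArg (⟪·, (e : K)⟫_ℂ) (map_add V a b)).trans <| by
    rw [inner_add_left, hVb, add_zero]
    exact h ⟨a, ha⟩

end Restriction

theorem mem_wanderingSpace_isometryDirectSum {H H' : Type*} [NormedAddCommGroup H]
    [InnerProductSpace ℂ H] [NormedAddCommGroup H'] [InnerProductSpace ℂ H'] {V : H →ₗᵢ[ℂ] H}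
    {V' : H' →ₗᵢ[ℂ] H'} {e : WithLp 2 (H × H')} :
    e ∈ wanderingSpace (isometryDirectSum V V') ↔
      e.fst ∈ wanderingSpace V ∧ e.snd ∈ wanderingSpace V' := by
  simp only [mem_defectSpace_iff]
  refine ⟨fun h => ⟨fun x => ?_, fun x => ?_⟩, fun h x => ?_⟩
  · simpa [isometryDirectSum] using h (WithLp.toLp 2 (x, 0))
  · simpa [isometryDirectSum] using h (WithLp.toLp 2 (0, x))
  · simpa [isometryDirectSum] using congrArg₂ (· + ·) (h.1 x.fst) (h.2 x.snd)

theorem dense_span_of_forall_inner_eq_zero {E ι : Type*} [NormedAddCommGroup E]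
    [InnerProductSpace ℂ E] [CompleteSpace E] {x : ι → E} (h : ∀ v, (∀ i, ⟪x i, v⟫_ℂ = 0) → v = 0) :
    Dense (Submodule.span ℂ (Set.range x) : Set E) := by
  rw [Submodule.dense_iff_topologicalClosure_eq_top, Submodule.topologicalClosure_eq_top_iff,
    Submodule.eq_bot_iff]
  exact fun v hv => h v fun i =>
    (Submodule.mem_orthogonal _ _).1 hv _ (Submodule.subset_span ⟨i, rfl⟩)

namespace BiIsometry

section ShiftSpace

variable {K : Type*} [NormedAddCommGroup K] [InnerProductSpace ℂ K] (W : BiIsometry K)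

theorem iterate_mem_shiftSpace (k : ℕ) (e : wanderingSpace W.W₀) :
    W.W₀^[k] e ∈ W.shiftSpace := by
  induction k with
  | zero => exact Submodule.le_topologicalClosure _ (Submodule.mem_iSup_of_mem 0 ⟨e, e.2, rfl⟩)
  | succ k ih =>
    rw [Function.iterate_succ_apply']
    exact W.map_mem_shiftSpace _ ih

theorem wanderingSpace_le_shiftSpace : wanderingSpace W.W₀ ≤ W.shiftSpace :=
  fun e he => W.iterate_mem_shiftSpace 0 ⟨e, he⟩

theorem shiftSpace_le {M : Submodule ℂ K} (hM : IsClosed (M : Set K))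
    (h : ∀ (k : ℕ) (e : wanderingSpace W.W₀), W.W₀^[k] e ∈ M) : W.shiftSpace ≤ M := by
  refine Submodule.topologicalClosure_minimal _ (iSup_le fun k => ?_) hM
  rintro _ ⟨e, he, rfl⟩
  simpa [Module.End.pow_apply] using h k ⟨e, he⟩

theorem mem_orthogonal_shiftSpace_iff {r : K} :
    r ∈ W.shiftSpaceᗮ ↔ ∀ (k : ℕ) (e : wanderingSpace W.W₀), ⟪W.W₀^[k] e, r⟫_ℂ = 0 := by
  refine ⟨fun h k e => h _ (W.iterate_mem_shiftSpace k e), fun h => ?_⟩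
  have hr : W.shiftSpace ≤ (ℂ ∙ r)ᗮ := W.shiftSpace_le (Submodule.isClosed_orthogonal _)
    fun k e => Submodule.mem_orthogonal_singleton_iff_inner_left.2 (h k e)
  exact fun x hx => Submodule.mem_orthogonal_singleton_iff_inner_left.1 (hr hx)

theorem le_orthogonal_shiftSpace {M : Submodule ℂ K} (hM : ∀ y ∈ M, ∃ x ∈ M, W.W₀ x = y) :
    M ≤ W.shiftSpaceᗮ := fun r hr => by
  refine W.mem_orthogonal_shiftSpace_iff.2 fun k e => ?_
  induction k generalizing r with
  | zero =>
    obtain ⟨s, -, rfl⟩ := hM r hr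
    exact inner_eq_zero_symm.1 (mem_defectSpace_iff.1 e.2 s)
  | succ k ih =>
    obtain ⟨s, hs, rfl⟩ := hM r hr
    rw [Function.iterate_succ_apply', W.W₀.inner_map_map]
    exact ih s hs

variable [CompleteSpace K]

theorem exists_mem_orthogonal_W₀_eq {r : K} (hr : r ∈ W.shiftSpaceᗮ) :
    ∃ s ∈ W.shiftSpaceᗮ, W.W₀ s = r := by
  have hr' := W.mem_orthogonal_shiftSpace_iff.1 hr
  have hrange : r ∈ (wanderingSpace W.W₀)ᗮ := fun e he => hr' 0 ⟨e, he⟩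
  rw [orthogonal_wanderingSpace] at hrange
  obtain ⟨s, rfl⟩ := hrange
  refine ⟨s, W.mem_orthogonal_shiftSpace_iff.2 fun k e => ?_, rfl⟩
  have hs := hr' (k + 1) e
  rwa [Function.iterate_succ_apply', LinearIsometry.coe_toLinearMap, W.W₀.inner_map_map] at hs

theorem map_mem_orthogonal_shiftSpace {T : K →ₗ[ℂ] K} (hT : ∀ x, T (W.W₀ x) = W.W₀ (T x)) {r : K}
    (hr : r ∈ W.shiftSpaceᗮ) : T r ∈ W.shiftSpaceᗮ := by
  refine W.le_orthogonal_shiftSpace (M := W.shiftSpaceᗮ.map T) ?_ (Submodule.mem_map_of_mem hr)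
  rintro _ ⟨y, hy, rfl⟩
  obtain ⟨x, hx, rfl⟩ := W.exists_mem_orthogonal_W₀_eq hy
  exact ⟨T x, Submodule.mem_map_of_mem hx, (hT x).symm⟩

theorem W₀_mem_orthogonal_shiftSpace {r : K} (hr : r ∈ W.shiftSpaceᗮ) : W.W₀ r ∈ W.shiftSpaceᗮ :=
  W.map_mem_orthogonal_shiftSpace (T := W.W₀.toLinearMap) (fun _ => rfl) hr

theorem W₁_mem_orthogonal_shiftSpace {r : K} (hr : r ∈ W.shiftSpaceᗮ) : W.W₁ r ∈ W.shiftSpaceᗮ :=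
  W.map_mem_orthogonal_shiftSpace (T := W.W₁.toLinearMap) (fun x => (W.comm x).symm) hr

end ShiftSpace

section CharacteristicPair

variable {K : Type*} [NormedAddCommGroup K] [InnerProductSpace ℂ K] (W : BiIsometry K)

/-- The operator `V₀ = W₀ | ℌ` of the characteristic pair, bundled as an isometry. -/
def charIsometry : W.shiftSpace →ₗᵢ[ℂ] W.shiftSpace :=
  restrictIsometry W.W₀ W.shiftSpace W.map_mem_shiftSpace

variable [CompleteSpace K]

theorem mem_charSpace_iff {x : W.shiftSpace} :
    x ∈ W.charSpace ↔ (x : K) ∈ wanderingSpace W.W₀ :=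
  mem_wanderingSpace_restrictIsometry_iff W.map_mem_shiftSpace
    fun _ => W.W₀_mem_orthogonal_shiftSpace

theorem isUnilateralShift_charIsometry : IsUnilateralShift W.charIsometry := by
  refine dense_span_of_forall_inner_eq_zero fun x hx => ?_
  have hx' : (x : K) ∈ W.shiftSpaceᗮ := W.mem_orthogonal_shiftSpace_iff.2 fun k e => by
    let e' : W.shiftSpace := ⟨e, W.wanderingSpace_le_shiftSpace e.2⟩
    have hk : (W.charIsometry^[k] e' : K) = W.W₀^[k] e := coe_iterate_restrictIsometry _ k e'
    rw [← hk]
    exact hx (k, ⟨e', W.mem_charSpace_iff.2 e.2⟩)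
  exact Subtype.ext (inner_self_eq_zero.1 (hx' x x.2))

theorem orthogonalProjectionOnto_W₁ (x : K) :
    W.shiftSpace.orthogonalProjectionOnto (W.W₁ x) =
      W.charContraction (W.shiftSpace.orthogonalProjectionOnto x) := by
  rw [← sub_eq_zero]
  change W.shiftSpace.orthogonalProjectionOnto (W.W₁ x) -
    W.shiftSpace.orthogonalProjectionOnto (W.W₁ (W.shiftSpace.starProjection x)) = 0
  rw [← map_sub, ← map_sub, Submodule.orthogonalProjectionOnto_eq_zero_iff]
  exact W.W₁_mem_orthogonal_shiftSpace (W.shiftSpace.sub_starProjection_mem_orthogonal x)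

theorem orthogonalProjectionOnto_W₀ (x : K) :
    W.shiftSpace.orthogonalProjectionOnto (W.W₀ x) =
      W.charIsometry (W.shiftSpace.orthogonalProjectionOnto x) := by
  refine Subtype.ext (W.shiftSpace.eq_starProjection_of_mem_orthogonal (Subtype.coe_prop _) ?_)
  change W.W₀ x - W.W₀ (W.shiftSpace.starProjection x) ∈ W.shiftSpaceᗮ
  rw [← map_sub]
  exact W.W₀_mem_orthogonal_shiftSpace (W.shiftSpace.sub_starProjection_mem_orthogonal x)

theorem commute_charContraction_charIsometry :
    Function.Commute W.charContraction W.charIsometry := fun x => by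
  rw [← W.shiftSpace.orthogonalProjectionOnto_mem_subspace_eq_self x,
    ← orthogonalProjectionOnto_W₀, ← orthogonalProjectionOnto_W₁, ← W.comm,
    orthogonalProjectionOnto_W₀, orthogonalProjectionOnto_W₁]

/-- The characteristic space `𝔈`, as a subspace of `ℌ`, is the wandering subspace of `W₀` in the
whole space. -/
def charSpaceEquiv : W.charSpace ≃ₗᵢ[ℂ] wanderingSpace W.W₀ where
  toFun x := ⟨x.1, W.mem_charSpace_iff.1 x.2⟩
  invFun e := ⟨⟨e, W.wanderingSpace_le_shiftSpace e.2⟩, W.mem_charSpace_iff.2 e.2⟩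
  map_add' _ _ := rfl
  map_smul' _ _ := rfl
  left_inv _ := rfl
  right_inv _ := rfl
  norm_map' _ := rfl

theorem charSpaceEquiv_charFunction {z : ℂ} (hz : ‖z‖ < 1) (x : W.charSpace) :
    W.charSpaceEquiv (W.charFunction z x) =
      pairFunction W.W₀.toContinuousLinearMap W.W₁.toContinuousLinearMap z
        (W.charSpaceEquiv x) := by
  have hP (e : wanderingSpace W.W₀) : W.shiftSpace.orthogonalProjectionOnto e =
      (W.charSpaceEquiv.symm e : W.shiftSpace) :=
    W.shiftSpace.orthogonalProjectionOnto_mem_subspace_eq_self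
      ⟨e, W.wanderingSpace_le_shiftSpace e.2⟩
  have h := coe_pairFunction_of_intertwine (V' := W.charIsometry)
    (A := W.W₁.toContinuousLinearMap) W.orthogonalProjectionOnto_W₀ W.orthogonalProjectionOnto_W₁
    (fun e he => hP ⟨e, he⟩ ▸ Subtype.coe_prop _) hz (hP (W.charSpaceEquiv x)).symm
  rw [hP] at h
  exact W.charSpaceEquiv.eq_symm_apply.1 (Subtype.ext h)

theorem functionsUnitarilyEquivalent_charFunction :
    FunctionsUnitarilyEquivalent W.charFunction
      (pairFunction W.W₀.toContinuousLinearMap W.W₁.toContinuousLinearMap) :=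
  ⟨W.charSpaceEquiv, fun _ hz x => W.charSpaceEquiv_charFunction (mem_ball_zero_iff.1 hz) x⟩

end CharacteristicPair

section UnitaryInvariance

variable {K : Type*} [NormedAddCommGroup K] [InnerProductSpace ℂ K] [CompleteSpace K]
  {K' : Type*} [NormedAddCommGroup K'] [InnerProductSpace ℂ K'] [CompleteSpace K']
  {W : BiIsometry K} {W' : BiIsometry K'}

theorem UnitarilyEquivalent.functionsUnitarilyEquivalent (h : W.UnitarilyEquivalent W') :
    FunctionsUnitarilyEquivalent W.charFunction W'.charFunction := by
  obtain ⟨U, h₀, h₁⟩ := h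
  have hU (e : K) : U e ∈ wanderingSpace W'.W₀ ↔ e ∈ wanderingSpace W.W₀ := by
    simp only [mem_defectSpace_iff]
    rw [← U.forall_congr_right]
    simp [← h₀]
  have hpair := functionsUnitarilyEquivalent_of_intertwine (T := (U : K →L[ℂ] K'))
    (A := W.W₁.toContinuousLinearMap) (A' := W'.W₁.toContinuousLinearMap) h₀ h₁
    (fun e => (hU e).2) (fun e _ => U.norm_map e)
    fun e' he' => ⟨U.symm e', by simpa [← hU] using he', U.apply_symm_apply e'⟩
  exact (W.functionsUnitarilyEquivalent_charFunction.trans hpair).trans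
    W'.functionsUnitarilyEquivalent_charFunction.symm

end UnitaryInvariance

section DirectSum

variable {K : Type*} [NormedAddCommGroup K] [InnerProductSpace ℂ K] [CompleteSpace K]
  {K' : Type*} [NormedAddCommGroup K'] [InnerProductSpace ℂ K'] [CompleteSpace K']
  (W : BiIsometry K) (W' : BiIsometry K')

/-- The natural identification of `𝔈 ⊕ 𝔈'` with the characteristic space of `𝕎 ⊕ 𝕎'`. -/
def charSpaceDirectSum :
    WithLp 2 (W.charSpace × W'.charSpace) ≃ₗᵢ[ℂ] (W.directSum W').charSpace where
  toFun x := (W.directSum W').charSpaceEquiv.symm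
    ⟨WithLp.toLp 2 (W.charSpaceEquiv x.fst, W'.charSpaceEquiv x.snd),
      mem_wanderingSpace_isometryDirectSum.2 ⟨Subtype.coe_prop _, Subtype.coe_prop _⟩⟩
  invFun y :=
    have hy := mem_wanderingSpace_isometryDirectSum.1 ((W.directSum W').mem_charSpace_iff.1 y.2)
    WithLp.toLp 2 (W.charSpaceEquiv.symm ⟨_, hy.1⟩, W'.charSpaceEquiv.symm ⟨_, hy.2⟩)
  map_add' _ _ := rfl
  map_smul' _ _ := rfl
  left_inv _ := rfl
  right_inv _ := rfl
  norm_map' x := (WithLp.prod_norm_eq_of_L2 _).trans (WithLp.prod_norm_eq_of_L2 x).symm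

theorem coe_charSpaceDirectSum (x : WithLp 2 (W.charSpace × W'.charSpace)) :
    ((W.charSpaceDirectSum W' x : (W.directSum W').shiftSpace) : WithLp 2 (K × K')) =
      WithLp.toLp 2 (((x.fst : W.shiftSpace) : K), ((x.snd : W'.shiftSpace) : K')) :=
  rfl

theorem charFunction_directSum {z : ℂ} (hz : ‖z‖ < 1) (x : WithLp 2 (W.charSpace × W'.charSpace)) :
    (W.directSum W').charFunction z (W.charSpaceDirectSum W' x) =
      W.charSpaceDirectSum W'
        (WithLp.toLp 2 (W.charFunction z x.fst, W'.charFunction z x.snd)) := by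
  have h₁ := coe_pairFunction_of_intertwine (T := WithLp.fstL 2 ℂ K K')
    (V := (W.directSum W').W₀) (V' := W.W₀)
    (A := (W.directSum W').W₁.toContinuousLinearMap) (A' := W.W₁.toContinuousLinearMap)
    (fun _ => rfl) (fun _ => rfl) (fun _ he => (mem_wanderingSpace_isometryDirectSum.1 he).1) hz
    (e := (W.directSum W').charSpaceEquiv (W.charSpaceDirectSum W' x))
    (e' := W.charSpaceEquiv x.fst) rfl
  have h₂ := coe_pairFunction_of_intertwine (T := WithLp.sndL 2 ℂ K K')
    (V := (W.directSum W').W₀) (V' := W'.W₀)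
    (A := (W.directSum W').W₁.toContinuousLinearMap) (A' := W'.W₁.toContinuousLinearMap)
    (fun _ => rfl) (fun _ => rfl) (fun _ he => (mem_wanderingSpace_isometryDirectSum.1 he).2) hz
    (e := (W.directSum W').charSpaceEquiv (W.charSpaceDirectSum W' x))
    (e' := W'.charSpaceEquiv x.snd) rfl
  rw [← charSpaceEquiv_charFunction _ hz, ← charSpaceEquiv_charFunction _ hz] at h₁ h₂
  exact Subtype.ext (Subtype.ext (WithLp.ofLp_injective 2 (Prod.ext h₁.symm h₂.symm)))

end DirectSum

section Reducing

variable {K : Type*} [NormedAddCommGroup K] [InnerProductSpace ℂ K] [CompleteSpace K]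
  {W : BiIsometry K} {M : Submodule ℂ K}

theorem IsReducing.orthogonal (hM : W.IsReducing M) : W.IsReducing Mᗮ := by
  have hMM : Mᗮᗮ = M := by
    rw [Submodule.orthogonal_orthogonal_eq_closure, hM.isClosed.submodule_topologicalClosure_eq]
  exact ⟨M.isClosed_orthogonal, hM.orth_inv₀, hM.orth_inv₁, by rw [hMM]; exact hM.inv₀,
    by rw [hMM]; exact hM.inv₁⟩

theorem isReducing_iff : W.IsReducing M ↔ IsClosed (M : Set K) ∧
    ((∀ x ∈ M, W.W₀ x ∈ M) ∧ ∀ x ∈ M, W.W₁ x ∈ M) ∧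
      (∀ x ∈ M, W.W₀†ᵢ x ∈ M) ∧ ∀ x ∈ M, W.W₁†ᵢ x ∈ M := by
  have adjoint_mem {N : Submodule ℂ K} {T : K →L[ℂ] K} (hT : ∀ x ∈ N, T x ∈ N) :
      ∀ x ∈ Nᗮ, (T†) x ∈ Nᗮ := fun x hx y hy => by
    rw [ContinuousLinearMap.adjoint_inner_right]
    exact hx _ (hT y hy)
  refine ⟨fun h => ⟨h.isClosed, ⟨h.inv₀, h.inv₁⟩, ?_⟩, fun ⟨hcl, ⟨h₀, h₁⟩, h₀', h₁'⟩ =>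
    ⟨hcl, h₀, h₁, ?_, ?_⟩⟩
  · rw [← h.isClosed.submodule_topologicalClosure_eq, ← M.orthogonal_orthogonal_eq_closure]
    exact ⟨adjoint_mem h.orth_inv₀, adjoint_mem h.orth_inv₁⟩
  · simpa using adjoint_mem h₀'
  · simpa using adjoint_mem h₁'

theorem W₀_adjoint_W₀ {r : K} (hr : r ∈ W.shiftSpaceᗮ) : W.W₀ (W.W₀†ᵢ r) = r := by
  obtain ⟨s, -, rfl⟩ := W.exists_mem_orthogonal_W₀_eq hr
  rw [adjoint_isometry_apply]

theorem isReducing_sInf {S : Set (Submodule ℂ K)} (hS : ∀ M ∈ S, W.IsReducing M) :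
    W.IsReducing (sInf S) := by
  have mem_sInf {T : K →L[ℂ] K} (hT : ∀ M ∈ S, ∀ x ∈ M, T x ∈ M) : ∀ x ∈ sInf S, T x ∈ sInf S :=
    fun x hx => Submodule.mem_sInf.2 fun M hM => hT M hM x (Submodule.mem_sInf.1 hx M hM)
  refine isReducing_iff.2 ⟨?_,
    ⟨mem_sInf (T := W.W₀.toContinuousLinearMap) fun M hM => (hS M hM).inv₀,
      mem_sInf (T := W.W₁.toContinuousLinearMap) fun M hM => (hS M hM).inv₁⟩,
    mem_sInf fun M hM => (isReducing_iff.1 (hS M hM)).2.2.1,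
    mem_sInf fun M hM => (isReducing_iff.1 (hS M hM)).2.2.2⟩
  rw [Submodule.coe_sInf]
  exact isClosed_biInter fun M hM => (hS M hM).isClosed

theorem isZeroPure_iff :
    W.IsZeroPure ↔ ∀ M : Submodule ℂ K, W.IsReducing M → W.shiftSpace ≤ M → M = ⊤ := by
  refine ⟨fun hW M hM hle => ?_, fun h M hM hsurj => ?_⟩
  · have hMo : Mᗮ = ⊥ := hW _ hM.orthogonal fun y hy =>
      ⟨_, (isReducing_iff.1 hM.orthogonal).2.2.1 y hy,
        W₀_adjoint_W₀ (Submodule.orthogonal_le hle hy)⟩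
    rw [← hM.isClosed.submodule_topologicalClosure_eq, Submodule.topologicalClosure_eq_top_iff, hMo]
  · have hMo : Mᗮ = ⊤ := h _ hM.orthogonal
      (W.shiftSpace.le_orthogonal_orthogonal.trans
        (Submodule.orthogonal_le (W.le_orthogonal_shiftSpace hsurj)))
    rw [eq_bot_iff, ← Submodule.top_orthogonal_eq_bot, ← hMo]
    exact M.le_orthogonal_orthogonal

end Reducing

section PurePart

variable {K : Type*} [NormedAddCommGroup K] [InnerProductSpace ℂ K]

/-- The restriction of a bi-isometry to a reducing subspace. -/
def restrict (W : BiIsometry K) {N : Submodule ℂ K} (hN : W.IsReducing N) : BiIsometry N where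
  W₀ := restrictIsometry W.W₀ N hN.inv₀
  W₁ := restrictIsometry W.W₁ N hN.inv₁
  comm x := Subtype.ext (W.comm x)

/-- The space of the `{0}`-pure part of a bi-isometry: the least reducing subspace containing
the shift space of `W₀`. -/
def pureSpace (W : BiIsometry K) : Submodule ℂ K :=
  sInf {M | W.IsReducing M ∧ W.shiftSpace ≤ M}

variable (W : BiIsometry K)

theorem shiftSpace_le_pureSpace : W.shiftSpace ≤ W.pureSpace :=
  le_sInf fun _ hM => hM.2

section Restrict

variable {W} {N : Submodule ℂ K} [CompleteSpace N] (hN : W.IsReducing N)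
include hN

theorem coe_mem_wanderingSpace_restrict_iff {e : N} :
    (e : K) ∈ wanderingSpace W.W₀ ↔ e ∈ wanderingSpace (W.restrict hN).W₀ :=
  (mem_wanderingSpace_restrictIsometry_iff _ hN.orth_inv₀).symm

omit [CompleteSpace N] in
theorem IsReducing.isClosed_map_subtype {P : Submodule ℂ N} (hP : IsClosed (P : Set N)) :
    IsClosed (P.map N.subtype : Set K) :=
  hN.isClosed.isClosedEmbedding_subtypeVal.isClosedMap _ hP

theorem shiftSpace_le_map_shiftSpace_restrict (hle : W.shiftSpace ≤ N) :
    W.shiftSpace ≤ (W.restrict hN).shiftSpace.map N.subtype := by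
  refine W.shiftSpace_le (hN.isClosed_map_subtype (Submodule.isClosed_topologicalClosure _))
    fun k e => ?_
  have he : (e : K) ∈ N := hle (W.wanderingSpace_le_shiftSpace e.2)
  exact ⟨_, (W.restrict hN).iterate_mem_shiftSpace k
    ⟨⟨e, he⟩, (coe_mem_wanderingSpace_restrict_iff hN).1 e.2⟩, coe_iterate_restrictIsometry _ k _⟩

variable [CompleteSpace K]

theorem IsReducing.map_subtype {P : Submodule ℂ N} (hP : (W.restrict hN).IsReducing P) :
    W.IsReducing (P.map N.subtype) := by
  obtain ⟨hcl, ⟨h₀, h₁⟩, h₀', h₁'⟩ := isReducing_iff.1 hP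
  refine isReducing_iff.2 ⟨?_, ⟨?_, ?_⟩, ?_, ?_⟩
  · exact hN.isClosed_map_subtype hcl
  all_goals rintro _ ⟨x, hx, rfl⟩
  · exact ⟨_, h₀ x hx, rfl⟩
  · exact ⟨_, h₁ x hx, rfl⟩
  · exact ⟨_, h₀' x hx, map_adjoint_of_intertwine (T := N.subtypeL) (fun _ => rfl)
      (fun _ => (mem_wanderingSpace_restrictIsometry_iff _ hN.orth_inv₀).1) x⟩
  · exact ⟨_, h₁' x hx, map_adjoint_of_intertwine (T := N.subtypeL) (fun _ => rfl)
      (fun _ => (mem_wanderingSpace_restrictIsometry_iff _ hN.orth_inv₁).1) x⟩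

theorem functionsUnitarilyEquivalent_restrict (hle : W.shiftSpace ≤ N) :
    FunctionsUnitarilyEquivalent (W.restrict hN).charFunction W.charFunction := by
  refine ((W.restrict hN).functionsUnitarilyEquivalent_charFunction.trans ?_).trans
    W.functionsUnitarilyEquivalent_charFunction.symm
  exact functionsUnitarilyEquivalent_of_intertwine (T := N.subtypeL) (fun _ => rfl) (fun _ => rfl)
    (fun _ => (coe_mem_wanderingSpace_restrict_iff hN).2) (fun _ _ => rfl) fun e he =>
      ⟨⟨e, hle (W.wanderingSpace_le_shiftSpace he)⟩,
        (coe_mem_wanderingSpace_restrict_iff hN).1 he, rfl⟩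

end Restrict

variable [CompleteSpace K]

theorem isReducing_pureSpace : W.IsReducing W.pureSpace :=
  isReducing_sInf fun _ hM => hM.1

theorem isZeroPure_restrict_pureSpace [CompleteSpace W.pureSpace] :
    (W.restrict W.isReducing_pureSpace).IsZeroPure := by
  refine isZeroPure_iff.2 fun P hP hle => eq_top_iff.2 fun x _ => ?_
  have hx : (x : K) ∈ P.map W.pureSpace.subtype := Submodule.mem_sInf.1 x.2 _
    ⟨W.isReducing_pureSpace.map_subtype hP,
      (shiftSpace_le_map_shiftSpace_restrict W.isReducing_pureSpace W.shiftSpace_le_pureSpace).trans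
        (Submodule.map_mono hle)⟩
  simpa using hx

end PurePart

section ResidualPart

variable {K : Type*} [NormedAddCommGroup K] [InnerProductSpace ℂ K] [CompleteSpace K]
  (W : BiIsometry K)

theorem adjoint_W₀_mem_orthogonal_shiftSpace {r : K} (hr : r ∈ W.shiftSpaceᗮ) :
    W.W₀†ᵢ r ∈ W.shiftSpaceᗮ := by
  obtain ⟨s, hs, rfl⟩ := W.exists_mem_orthogonal_W₀_eq hr
  rwa [adjoint_isometry_apply]

theorem W₁_adjoint_W₀ {r : K} (hr : r ∈ W.shiftSpaceᗮ) :
    W.W₁ (W.W₀†ᵢ r) = W.W₀†ᵢ (W.W₁ r) := by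
  obtain ⟨s, -, rfl⟩ := W.exists_mem_orthogonal_W₀_eq hr
  rw [adjoint_isometry_apply, ← W.comm, adjoint_isometry_apply]

theorem adjoint_W₁_adjoint_W₀ (x : K) : W.W₁†ᵢ (W.W₀†ᵢ x) = W.W₀†ᵢ (W.W₁†ᵢ x) := by
  refine ext_inner_left ℂ fun y => ?_
  simp only [ContinuousLinearMap.adjoint_inner_right, LinearIsometry.coe_toContinuousLinearMap,
    W.comm]

theorem adjoint_mem_shiftSpace {T : K →L[ℂ] K} (hT : ∀ r ∈ W.shiftSpaceᗮ, T r ∈ W.shiftSpaceᗮ)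
    {x : K} (hx : x ∈ W.shiftSpace) : (T†) x ∈ W.shiftSpace := by
  rw [← W.shiftSpace.orthogonal_orthogonal]
  intro r hr
  rw [ContinuousLinearMap.adjoint_inner_right]
  exact Submodule.inner_left_of_mem_orthogonal hx (hT r hr)

/-- The off-diagonal entry `h ↦ W₁ h - A h` of `W₁` with respect to `𝔎 = ℌ ⊕ ℌᗮ`. -/
def offDiag : W.shiftSpace →L[ℂ] K :=
  W.W₁.toContinuousLinearMap ∘L W.shiftSpace.subtypeL - W.shiftSpace.subtypeL ∘L W.charContraction

theorem W₁_coe (h : W.shiftSpace) : W.W₁ h = (W.charContraction h : K) + W.offDiag h :=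
  (add_sub_cancel _ _).symm

theorem offDiag_mem (h : W.shiftSpace) : W.offDiag h ∈ W.shiftSpaceᗮ :=
  W.shiftSpace.sub_starProjection_mem_orthogonal (W.W₁ h)

theorem semiconj_offDiag : Function.Semiconj W.offDiag W.charIsometry W.W₀ := fun h => by
  have hA := congrArg ((↑) : W.shiftSpace → K) (W.commute_charContraction_charIsometry h)
  change W.W₁ (W.W₀ h) - W.charContraction (W.charIsometry h) = W.W₀ (W.W₁ h - W.charContraction h)
  rw [hA, map_sub, W.comm]
  rfl

theorem inner_offDiag (h h' : W.shiftSpace) : ⟪W.offDiag h, W.offDiag h'⟫_ℂ =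
    ⟪h, h'⟫_ℂ - ⟪W.charContraction h, W.charContraction h'⟫_ℂ := by
  have hW₁ : ⟪W.W₁ h, W.W₁ h'⟫_ℂ = ⟪h, h'⟫_ℂ := W.W₁.inner_map_map _ _
  have hAD := Submodule.inner_right_of_mem_orthogonal (W.charContraction h).2 (W.offDiag_mem h')
  have hDA := Submodule.inner_left_of_mem_orthogonal (W.charContraction h').2 (W.offDiag_mem h)
  rw [W₁_coe, W₁_coe, inner_add_left, inner_add_right, inner_add_right, hAD, hDA] at hW₁
  rw [← hW₁, Submodule.coe_inner]
  ring

theorem inner_W₁_offDiag {s : K} (hs : s ∈ W.shiftSpaceᗮ) (h : W.shiftSpace) :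
    ⟪W.W₁ s, W.offDiag h⟫_ℂ = 0 := by
  have hA := Submodule.inner_left_of_mem_orthogonal (W.charContraction h).2
    (W.W₁_mem_orthogonal_shiftSpace hs)
  rw [eq_sub_of_add_eq' (W.W₁_coe h).symm, inner_sub_right, hA, W.W₁.inner_map_map, sub_zero]
  exact Submodule.inner_left_of_mem_orthogonal h.2 hs

theorem inner_iterate_W₁_offDiag (m m' : ℕ) (h h' : W.shiftSpace) :
    ⟪W.W₁^[m] (W.offDiag h), W.W₁^[m'] (W.offDiag h')⟫_ℂ =
      if m = m' then ⟪W.offDiag h, W.offDiag h'⟫_ℂ else 0 := by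
  let R := restrictIsometry W.W₁ W.shiftSpaceᗮ fun _ => W.W₁_mem_orthogonal_shiftSpace
  let D (h : W.shiftSpace) : wanderingSpace R :=
    ⟨⟨W.offDiag h, W.offDiag_mem h⟩, mem_defectSpace_iff.2 fun s => W.inner_W₁_offDiag s.2 h⟩
  have hR (m : ℕ) (h : W.shiftSpace) : (R^[m] (D h) : K) = W.W₁^[m] (W.offDiag h) :=
    coe_iterate_restrictIsometry _ m _
  rw [← hR, ← hR]
  exact inner_iterate_iterate_wanderingSpace R m m' (D h) (D h')

/-- The vectors `W₀*ⁿ W₁ᵐ (W₁ h - A h)`, which generate the part of a `{0}`-pure bi-isometry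
orthogonal to the shift space. -/
def orbit (n m : ℕ) (h : W.shiftSpace) : K :=
  W.W₀†ᵢ^[n] (W.W₁^[m] (W.offDiag h))

theorem orbit_succ (n m : ℕ) (h : W.shiftSpace) :
    W.orbit (n + 1) m h = W.W₀†ᵢ (W.orbit n m h) :=
  Function.iterate_succ_apply' _ _ _

theorem orbit_mem (n m : ℕ) (h : W.shiftSpace) : W.orbit n m h ∈ W.shiftSpaceᗮ := by
  have hm : W.W₁^[m] (W.offDiag h) ∈ W.shiftSpaceᗮ :=
    Set.MapsTo.iterate (s := (W.shiftSpaceᗮ : Set K))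
      (fun _ => W.W₁_mem_orthogonal_shiftSpace) m (W.offDiag_mem h)
  exact Set.MapsTo.iterate (s := (W.shiftSpaceᗮ : Set K))
    (fun _ => W.adjoint_W₀_mem_orthogonal_shiftSpace) n hm

theorem W₀_orbit (n m : ℕ) (h : W.shiftSpace) :
    W.W₀ (W.orbit n m h) = W.orbit n m (W.charIsometry h) := by
  induction n with
  | zero =>
    have hcomm : Function.Commute W.W₀ W.W₁ := W.comm
    exact (hcomm.iterate_right m (W.offDiag h)).trans (congrArg _ (W.semiconj_offDiag h).symm)
  | succ n ih => rw [orbit_succ, orbit_succ, W₀_adjoint_W₀ (W.orbit_mem n m h), ← ih,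
      adjoint_isometry_apply]

theorem W₁_orbit (n m : ℕ) (h : W.shiftSpace) : W.W₁ (W.orbit n m h) = W.orbit n (m + 1) h := by
  induction n with
  | zero => exact (Function.iterate_succ_apply' W.W₁ m (W.offDiag h)).symm
  | succ n ih => rw [orbit_succ, orbit_succ, W₁_adjoint_W₀ W (W.orbit_mem n m h), ih]

theorem adjoint_W₁_orbit_zero_mem (n : ℕ) (h : W.shiftSpace) :
    W.W₁†ᵢ (W.orbit n 0 h) ∈ W.shiftSpace := by
  induction n with
  | zero =>
    change W.W₁†ᵢ (W.W₁ h - W.charContraction h) ∈ W.shiftSpace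
    rw [map_sub, adjoint_isometry_apply]
    exact sub_mem h.2 (W.adjoint_mem_shiftSpace (fun _ => W.W₁_mem_orthogonal_shiftSpace)
      (Subtype.coe_prop _))
  | succ n ih =>
    rw [orbit_succ, adjoint_W₁_adjoint_W₀]
    exact W.adjoint_mem_shiftSpace (fun _ => W.W₀_mem_orthogonal_shiftSpace) ih

theorem iterate_W₀_orbit (n m : ℕ) (h : W.shiftSpace) :
    W.W₀^[n] (W.orbit n m h) = W.W₁^[m] (W.offDiag h) := by
  induction n with
  | zero => rfl
  | succ n ih =>
    rw [Function.iterate_succ_apply, orbit_succ, W₀_adjoint_W₀ (W.orbit_mem n m h), ih]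

theorem iterate_add_W₀_orbit (n k m : ℕ) (h : W.shiftSpace) :
    W.W₀^[n + k] (W.orbit n m h) = W.W₁^[m] (W.offDiag (W.charIsometry^[k] h)) := by
  have hk : Function.Semiconj (W.orbit n m) W.charIsometry W.W₀ := fun h => (W.W₀_orbit n m h).symm
  rw [Function.iterate_add_apply, ← hk.iterate_right k, iterate_W₀_orbit]

theorem inner_orbit (n n' m m' : ℕ) (h h' : W.shiftSpace) :
    ⟪W.orbit n m h, W.orbit n' m' h'⟫_ℂ = if m = m' then
      ⟪W.charIsometry^[n'] h, W.charIsometry^[n] h'⟫_ℂ -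
        ⟪W.charContraction (W.charIsometry^[n'] h), W.charContraction (W.charIsometry^[n] h')⟫_ℂ
      else 0 := by
  have hiso : ⟪W.orbit n m h, W.orbit n' m' h'⟫_ℂ =
      ⟪W.W₀^[n + n'] (W.orbit n m h), W.W₀^[n' + n] (W.orbit n' m' h')⟫_ℂ := by
    rw [add_comm n', ← LinearIsometry.coe_pow, LinearIsometry.inner_map_map]
  rw [hiso, iterate_add_W₀_orbit, iterate_add_W₀_orbit, inner_iterate_W₁_offDiag, inner_offDiag]

end ResidualPart

section Model

variable {K : Type*} [NormedAddCommGroup K] [InnerProductSpace ℂ K] [CompleteSpace K]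

/-- The vectors of the shift space together with their orbits: a generating family of a
`{0}`-pure bi-isometry, with Gram matrix determined by the characteristic pair. -/
def modelFamily (W : BiIsometry K) : W.shiftSpace ⊕ ℕ × ℕ × W.shiftSpace → K :=
  Sum.elim (↑) fun i => W.orbit i.1 i.2.1 i.2.2

theorem isReducing_closure_span_modelFamily (W : BiIsometry K) :
    W.IsReducing (Submodule.span ℂ (Set.range W.modelFamily)).topologicalClosure := by
  set N := (Submodule.span ℂ (Set.range W.modelFamily)).topologicalClosure
  have hmem (i) : W.modelFamily i ∈ N :=
    Submodule.le_topologicalClosure _ (Submodule.subset_span ⟨i, rfl⟩)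
  have hshift {h : K} (hh : h ∈ W.shiftSpace) : h ∈ N := hmem (.inl ⟨h, hh⟩)
  have horbit (n m h) : W.orbit n m h ∈ N := hmem (.inr (n, m, h))
  have hN {T : K →L[ℂ] K} (hl : ∀ h : W.shiftSpace, T h ∈ N) (hr : ∀ n m h, T (W.orbit n m h) ∈ N) :
      ∀ x ∈ N, T x ∈ N := by
    have hcl : IsClosed (N.comap (T : K →ₗ[ℂ] K) : Set K) :=
      (Submodule.isClosed_topologicalClosure _).preimage T.continuous
    exact fun x hx => Submodule.topologicalClosure_minimal _ (Submodule.span_le.2 <|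
      Set.range_subset_iff.2 <| Sum.rec hl fun i => hr i.1 i.2.1 i.2.2) hcl hx
  refine isReducing_iff.2 ⟨Submodule.isClosed_topologicalClosure _,
    ⟨hN (T := W.W₀.toContinuousLinearMap) ?_ ?_, hN (T := W.W₁.toContinuousLinearMap) ?_ ?_⟩,
    hN ?_ ?_, hN ?_ ?_⟩
  · exact fun h => hshift (W.map_mem_shiftSpace _ h.2)
  · exact fun n m h => (W.W₀_orbit n m h).symm ▸ horbit n m _
  · exact fun h => (W.W₁_coe h).symm ▸ add_mem (hshift (Subtype.coe_prop _)) (horbit 0 0 h)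
  · exact fun n m h => (W.W₁_orbit n m h).symm ▸ horbit n (m + 1) h
  · exact fun h => hshift
      (W.adjoint_mem_shiftSpace (fun _ => W.W₀_mem_orthogonal_shiftSpace) h.2)
  · exact fun n m h => W.orbit_succ n m h ▸ horbit (n + 1) m h
  · exact fun h => hshift
      (W.adjoint_mem_shiftSpace (fun _ => W.W₁_mem_orthogonal_shiftSpace) h.2)
  · rintro n (_ | m) h
    · exact hshift (W.adjoint_W₁_orbit_zero_mem n h)
    · rw [← W₁_orbit, adjoint_isometry_apply]
      exact horbit n m h

theorem IsZeroPure.dense_span_modelFamily {W : BiIsometry K} (hW : W.IsZeroPure) :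
    Dense (Submodule.span ℂ (Set.range W.modelFamily) : Set K) :=
  Submodule.dense_iff_topologicalClosure_eq_top.2 <|
    isZeroPure_iff.1 hW _ W.isReducing_closure_span_modelFamily fun h hh =>
      Submodule.le_topologicalClosure _ (Submodule.subset_span ⟨.inl ⟨h, hh⟩, rfl⟩)

end Model

section Completeness

variable {K : Type*} [NormedAddCommGroup K] [InnerProductSpace ℂ K] [CompleteSpace K]
  {K' : Type*} [NormedAddCommGroup K'] [InnerProductSpace ℂ K'] [CompleteSpace K']
  {W : BiIsometry K} {W' : BiIsometry K'}

theorem inner_modelFamily_eq {Φ : W.shiftSpace ≃ₗᵢ[ℂ] W'.shiftSpace}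
    (hV : Function.Semiconj Φ W.charIsometry W'.charIsometry)
    (hA : Function.Semiconj Φ W.charContraction W'.charContraction)
    (i j : W.shiftSpace ⊕ ℕ × ℕ × W.shiftSpace) :
    ⟪W.modelFamily i, W.modelFamily j⟫_ℂ =
      ⟪W'.modelFamily (i.map Φ (Prod.map id (Prod.map id Φ))),
        W'.modelFamily (j.map Φ (Prod.map id (Prod.map id Φ)))⟫_ℂ := by
  obtain g | ⟨n, m, g⟩ := i <;> obtain g' | ⟨n', m', g'⟩ := j
  · exact (Φ.inner_map_map g g').symm
  · exact (Submodule.inner_right_of_mem_orthogonal g.2 (W.orbit_mem _ _ _)).trans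
      (Submodule.inner_right_of_mem_orthogonal (Φ g).2 (W'.orbit_mem _ _ _)).symm
  · exact (Submodule.inner_left_of_mem_orthogonal g'.2 (W.orbit_mem _ _ _)).trans
      (Submodule.inner_left_of_mem_orthogonal (Φ g').2 (W'.orbit_mem _ _ _)).symm
  · change ⟪W.orbit n m g, W.orbit n' m' g'⟫_ℂ = ⟪W'.orbit n m (Φ g), W'.orbit n' m' (Φ g')⟫_ℂ
    simp only [inner_orbit, ← hV.iterate_right _ _, ← hA _, Φ.inner_map_map]

theorem unitarilyEquivalent_of_intertwining_shiftSpace (hW : W.IsZeroPure) (hW' : W'.IsZeroPure)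
    {Φ : W.shiftSpace ≃ₗᵢ[ℂ] W'.shiftSpace}
    (hV : Function.Semiconj Φ W.charIsometry W'.charIsometry)
    (hA : Function.Semiconj Φ W.charContraction W'.charContraction) :
    W.UnitarilyEquivalent W' := by
  let σ : W.shiftSpace ⊕ ℕ × ℕ × W.shiftSpace → W'.shiftSpace ⊕ ℕ × ℕ × W'.shiftSpace :=
    Sum.map Φ (Prod.map id (Prod.map id Φ))
  have hσ : Function.Surjective σ := Φ.surjective.sumMap
    (Function.surjective_id.prodMap (Function.surjective_id.prodMap Φ.surjective))
  obtain ⟨U, hU⟩ := exists_unitary_of_gram_eq (y := W'.modelFamily ∘ σ)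
    (inner_modelFamily_eq hV hA) hW.dense_span_modelFamily
    (by rw [hσ.range_comp]; exact hW'.dense_span_modelFamily)
  have hshift (g : W.shiftSpace) : U g = Φ g := hU (.inl g)
  have horbit (n m g) : U (W.orbit n m g) = W'.orbit n m (Φ g) := hU (.inr (n, m, g))
  refine ⟨U, intertwine_of_dense_span (U := (U : K →L[ℂ] K')) (T := W.W₀.toContinuousLinearMap)
    (T' := W'.W₀.toContinuousLinearMap) hW.dense_span_modelFamily ?_,
    intertwine_of_dense_span (U := (U : K →L[ℂ] K')) (T := W.W₁.toContinuousLinearMap)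
    (T' := W'.W₁.toContinuousLinearMap) hW.dense_span_modelFamily ?_⟩
  · rintro (g | ⟨n, m, g⟩)
    · change U (W.charIsometry g) = W'.W₀ (U g)
      rw [hshift, hshift, hV]
      rfl
    · change U (W.W₀ (W.orbit n m g)) = W'.W₀ (U (W.orbit n m g))
      rw [W₀_orbit, horbit, horbit, hV, W₀_orbit]
  · rintro (g | ⟨n, m, g⟩)
    · change U (W.W₁ g) = W'.W₁ (U g)
      rw [W₁_coe, map_add, hshift, hA, hshift, W₁_coe]
      exact congrArg _ (horbit 0 0 g)
    · change U (W.W₁ (W.orbit n m g)) = W'.W₁ (U (W.orbit n m g))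
      rw [W₁_orbit, horbit, horbit, W₁_orbit]

theorem IsZeroPure.unitarilyEquivalent (hW : W.IsZeroPure) (hW' : W'.IsZeroPure)
    (h : FunctionsUnitarilyEquivalent W.charFunction W'.charFunction) :
    W.UnitarilyEquivalent W' := by
  obtain ⟨Φ, hV, hA⟩ := W.isUnilateralShift_charIsometry.exists_intertwining_unitary
    W'.isUnilateralShift_charIsometry W.commute_charContraction_charIsometry
    W'.commute_charContraction_charIsometry h
  exact unitarilyEquivalent_of_intertwining_shiftSpace hW hW' hV hA

end Completeness

end BiIsometry

section DiscreteParseval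

variable {F : Type*} [NormedAddCommGroup F] [InnerProductSpace ℂ F]
  {M : ℕ} {ζ : ℂ}

theorem sum_conj_pow_mul_pow_of_isPrimitiveRoot (hζ : IsPrimitiveRoot ζ M) {n m : ℕ} (hn : n < M)
    (hm : m < M) :
    ∑ j ∈ Finset.range M, (starRingEnd ℂ) ((ζ ^ j) ^ n) * (ζ ^ j) ^ m =
      if n = m then (M : ℂ) else 0 := by
  have hM : M ≠ 0 := by omega
  have hζ0 : ζ ≠ 0 := hζ.ne_zero hM
  have hterm : ∀ j, (starRingEnd ℂ) ((ζ ^ j) ^ n) * (ζ ^ j) ^ m = (ζ ^ m / ζ ^ n) ^ j := fun j => by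
    rw [map_pow, map_pow, ← Complex.inv_eq_conj (hζ.norm'_eq_one hM), div_eq_mul_inv]
    ring
  simp only [hterm]
  split_ifs with h
  · simp [h, hζ0]
  · have hne : ζ ^ m / ζ ^ n ≠ 1 := fun h1 =>
      h (hζ.pow_inj hn hm ((div_eq_one_iff_eq (pow_ne_zero n hζ0)).1 h1).symm)
    rw [geom_sum_eq hne, div_pow, pow_right_comm, hζ.pow_eq_one, pow_right_comm ζ, hζ.pow_eq_one]
    simp

theorem sum_norm_sq_sum_pow_smul_of_isPrimitiveRoot (hζ : IsPrimitiveRoot ζ M) {N : ℕ} (hN : N ≤ M)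
    (g : ℕ → F) :
    ∑ j ∈ Finset.range M, ‖∑ n ∈ Finset.range N, (ζ ^ j) ^ n • g n‖ ^ 2 =
      M * ∑ n ∈ Finset.range N, ‖g n‖ ^ 2 := by
  have hmn : ∀ n ∈ Finset.range N, ∀ m ∈ Finset.range N,
      ∑ j ∈ Finset.range M, (ζ ^ j) ^ m * ((starRingEnd ℂ) ((ζ ^ j) ^ n) * ⟪g n, g m⟫_ℂ) =
        if n = m then (M : ℂ) * ⟪g n, g m⟫_ℂ else 0 := fun n hn m hm => by
    simp only [mul_left_comm ((ζ ^ _) ^ m), ← mul_assoc]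
    rw [← Finset.sum_mul, sum_conj_pow_mul_pow_of_isPrimitiveRoot hζ
      ((Finset.mem_range.1 hn).trans_le hN) ((Finset.mem_range.1 hm).trans_le hN), ite_mul,
      zero_mul]
  have h : ∑ j ∈ Finset.range M, ⟪∑ n ∈ Finset.range N, (ζ ^ j) ^ n • g n,
      ∑ n ∈ Finset.range N, (ζ ^ j) ^ n • g n⟫_ℂ = M * ∑ n ∈ Finset.range N, ⟪g n, g n⟫_ℂ := by
    simp only [sum_inner, inner_sum, inner_smul_left, inner_smul_right]
    simp only [Finset.mul_sum]
    rw [Finset.sum_comm]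
    refine Finset.sum_congr rfl fun m hm => ?_
    rw [Finset.sum_comm, Finset.sum_congr rfl fun n hn => hmn n hn m hm, Finset.sum_ite_eq',
      if_pos hm]
  simp only [inner_self_eq_norm_sq_to_K] at h
  apply RCLike.ofReal_injective (K := ℂ)
  push_cast
  exact h

end DiscreteParseval

section Toeplitz

open Filter Topology
open Finset.HasAntidiagonal (antidiagonal mem_antidiagonal)

variable {F : Type*} [NormedAddCommGroup F] [InnerProductSpace ℂ F]
  {F' : Type*} [NormedAddCommGroup F'] [InnerProductSpace ℂ F'] {C : ℕ → F →L[ℂ] F'}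

/-- Multiplication by the formal power series `∑ zᵏ C k`, on sequences of coefficients. -/
def toeplitz (C : ℕ → F →L[ℂ] F') : (ℕ → F) →ₗ[ℂ] (ℕ → F') where
  toFun f n := ∑ p ∈ antidiagonal n, C p.1 (f p.2)
  map_add' f g := by
    funext n
    simp [Finset.sum_add_distrib]
  map_smul' c f := by
    funext n
    simp [Finset.smul_sum]

theorem toeplitz_apply (f : ℕ → F) (n : ℕ) :
    toeplitz C f n = ∑ p ∈ antidiagonal n, C p.1 (f p.2) := rfl

/-- The `n`-th coefficient of the product of the polynomials `∑_{k < K} zᵏ C k` and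
`∑_{l < N} zˡ f l`. -/
def truncatedConvolution (C : ℕ → F →L[ℂ] F') (f : ℕ → F) (K N n : ℕ) : F' :=
  ∑ p ∈ Finset.range K ×ˢ Finset.range N with p.1 + p.2 = n, C p.1 (f p.2)

theorem truncatedConvolution_eq_toeplitz (f : ℕ → F) {K N n : ℕ} (hK : n < K) (hN : n < N) :
    truncatedConvolution C f K N n = toeplitz C f n := by
  rw [truncatedConvolution, toeplitz_apply]
  refine Finset.sum_congr (Finset.ext fun p => ?_) fun _ _ => rfl
  simp only [Finset.mem_filter, Finset.mem_product, Finset.mem_range, mem_antidiagonal]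
  omega

theorem sum_pow_smul_truncatedConvolution (f : ℕ → F) (K N : ℕ) (w : ℂ) :
    ∑ n ∈ Finset.range (K + N), w ^ n • truncatedConvolution C f K N n =
      (∑ k ∈ Finset.range K, w ^ k • C k) (∑ l ∈ Finset.range N, w ^ l • f l) := by
  have hmaps : ∀ p ∈ Finset.range K ×ˢ Finset.range N, p.1 + p.2 ∈ Finset.range (K + N) :=
    fun p hp => by
      simp only [Finset.mem_product, Finset.mem_range] at hp ⊢
      omega
  calc _ = ∑ n ∈ Finset.range (K + N), ∑ p ∈ Finset.range K ×ˢ Finset.range N with p.1 + p.2 = n,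
        w ^ (p.1 + p.2) • C p.1 (f p.2) := by
        refine Finset.sum_congr rfl fun n _ => Finset.smul_sum.trans ?_
        exact Finset.sum_congr rfl fun p hp => by rw [(Finset.mem_filter.1 hp).2]
    _ = ∑ p ∈ Finset.range K ×ˢ Finset.range N, w ^ (p.1 + p.2) • C p.1 (f p.2) :=
        Finset.sum_fiberwise_of_maps_to hmaps _
    _ = _ := by
        simp only [Finset.sum_product_right, map_sum, sum_apply, map_smul, smul_apply, pow_add,
          mul_smul, Finset.smul_sum]
        exact Finset.sum_congr rfl fun l _ => Finset.sum_congr rfl fun k _ => smul_comm _ _ _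

theorem sum_norm_sq_toeplitz_le_of_partialSum_le (f : ℕ → F) {K N : ℕ} (hNK : N ≤ K) {B : ℝ}
    (hC : ∀ ζ : ℂ, ‖ζ‖ = 1 → ‖∑ k ∈ Finset.range K, ζ ^ k • C k‖ ≤ B) :
    ∑ n ∈ Finset.range N, ‖toeplitz C f n‖ ^ 2 ≤ B ^ 2 * ∑ l ∈ Finset.range N, ‖f l‖ ^ 2 := by
  rcases Nat.eq_zero_or_pos (K + N) with h0 | hpos
  · simp [show N = 0 by omega]
  have hζ := Complex.isPrimitiveRoot_exp (K + N) hpos.ne'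
  set ζ := Complex.exp (2 * Real.pi * Complex.I / (K + N : ℕ))
  have hζ1 : ∀ j : ℕ, ‖ζ ^ j‖ = 1 := fun j => by
    rw [norm_pow, hζ.norm'_eq_one hpos.ne', one_pow]
  have htrunc : ∑ n ∈ Finset.range (K + N), ‖truncatedConvolution C f K N n‖ ^ 2 ≤
      B ^ 2 * ∑ l ∈ Finset.range N, ‖f l‖ ^ 2 := by
    refine le_of_mul_le_mul_left ?_ (Nat.cast_pos.2 hpos : (0 : ℝ) < (K + N : ℕ))
    rw [← sum_norm_sq_sum_pow_smul_of_isPrimitiveRoot hζ le_rfl, mul_left_comm,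
      ← sum_norm_sq_sum_pow_smul_of_isPrimitiveRoot hζ (Nat.le_add_left N K), Finset.mul_sum]
    refine Finset.sum_le_sum fun j _ => ?_
    rw [sum_pow_smul_truncatedConvolution, ← mul_pow]
    gcongr
    exact ContinuousLinearMap.le_of_opNorm_le _ (hC _ (hζ1 j)) _
  refine le_trans ?_ (htrunc.trans' (Finset.sum_le_sum_of_subset_of_nonneg
    (Finset.range_subset_range.2 (Nat.le_add_left N K)) fun _ _ _ => sq_nonneg _))
  refine Finset.sum_le_sum fun n hn => ?_
  have hn' := Finset.mem_range.1 hn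
  rw [truncatedConvolution_eq_toeplitz f (hn'.trans_le hNK) hn']

theorem norm_sum_range_le_add_tsum {E : Type*} [NormedAddCommGroup E] [CompleteSpace E] {c : ℕ → E}
    {s : E} (hs : HasSum c s) (hc : Summable fun k => ‖c k‖) (K : ℕ) :
    ‖∑ k ∈ Finset.range K, c k‖ ≤ ‖s‖ + ∑' k, ‖c (k + K)‖ := by
  have h := hs.summable.sum_add_tsum_nat_add K
  rw [hs.tsum_eq] at h
  rw [eq_sub_of_add_eq h]
  exact (norm_sub_le _ _).trans (add_le_add_right
    (norm_tsum_le_tsum_norm ((summable_nat_add_iff (f := fun k => ‖c k‖) K).2 hc)) _)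

theorem sum_norm_sq_toeplitz_le_of_summable [CompleteSpace F'] (hC : Summable fun k => ‖C k‖)
    (hC1 : ∀ ζ : ℂ, ‖ζ‖ = 1 → ‖∑' k, ζ ^ k • C k‖ ≤ 1) (f : ℕ → F) (N : ℕ) :
    ∑ n ∈ Finset.range N, ‖toeplitz C f n‖ ^ 2 ≤ ∑ n ∈ Finset.range N, ‖f n‖ ^ 2 := by
  have hlim : Tendsto (fun K => (1 + ∑' k, ‖C (k + K)‖) ^ 2 * ∑ n ∈ Finset.range N, ‖f n‖ ^ 2) atTop
      (𝓝 ((1 + 0) ^ 2 * ∑ n ∈ Finset.range N, ‖f n‖ ^ 2)) :=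
    (((tendsto_sum_nat_add fun k => ‖C k‖).const_add 1).pow 2).mul_const _
  rw [add_zero, one_pow, one_mul] at hlim
  refine ge_of_tendsto hlim ?_
  filter_upwards [eventually_ge_atTop N] with K hK
  refine sum_norm_sq_toeplitz_le_of_partialSum_le f hK fun ζ hζ => ?_
  have hnorm : ∀ k, ‖ζ ^ k • C k‖ = ‖C k‖ := fun k => by simp [norm_smul, hζ]
  have hsum : Summable fun k => ‖ζ ^ k • C k‖ := by simpa only [hnorm] using hC
  refine (norm_sum_range_le_add_tsum hsum.of_norm.hasSum hsum K).trans ?_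
  simp only [hnorm]
  exact add_le_add_left (hC1 ζ hζ) _

theorem summable_norm_pow_smul_of_summable {E : Type*} [NormedAddCommGroup E] [NormedSpace ℂ E]
    {c : ℕ → E} {w z : ℂ} (hc : Summable fun n => w ^ n • c n) (hz : ‖z‖ < ‖w‖) :
    Summable fun n => ‖z ^ n • c n‖ := by
  have hw : 0 < ‖w‖ := (norm_nonneg z).trans_lt hz
  obtain ⟨B, hB⟩ := hc.tendsto_atTop_zero.norm.bddAbove_range
  refine .of_nonneg_of_le (fun n => norm_nonneg _) (fun n => ?_)
    ((summable_geometric_of_lt_one (by positivity) ((div_lt_one hw).2 hz)).mul_left B)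
  calc ‖z ^ n • c n‖ = ‖w ^ n • c n‖ * (‖z‖ / ‖w‖) ^ n := by
        rw [norm_smul, norm_smul, norm_pow, norm_pow, div_pow]
        field_simp
    _ ≤ B * (‖z‖ / ‖w‖) ^ n := by
        gcongr
        exact hB ⟨n, rfl⟩

-- The coefficients `rᵏ C k` of the dilates `Θ(r z)` are summable; now let `r → 1`.
theorem sum_norm_sq_toeplitz_le [CompleteSpace F'] {Θ : ℂ → F →L[ℂ] F'}
    (hC : ∀ z : ℂ, ‖z‖ < 1 → HasSum (fun n => z ^ n • C n) (Θ z))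
    (hΘ : ∀ z : ℂ, ‖z‖ < 1 → ‖Θ z‖ ≤ 1) (f : ℕ → F) (N : ℕ) :
    ∑ n ∈ Finset.range N, ‖toeplitz C f n‖ ^ 2 ≤ ∑ n ∈ Finset.range N, ‖f n‖ ^ 2 := by
  have hdilate : ∀ r : ℝ, 0 < r → r < 1 →
      ∑ n ∈ Finset.range N, ‖toeplitz (fun k => (r : ℂ) ^ k • C k) f n‖ ^ 2 ≤
        ∑ n ∈ Finset.range N, ‖f n‖ ^ 2 := fun r hr0 hr1 => by
    have hr : ‖(r : ℂ)‖ = r := by rw [Complex.norm_real, Real.norm_of_nonneg hr0.le]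
    obtain ⟨ρ, hrρ, hρ1⟩ := exists_between hr1
    have hρ : ‖(ρ : ℂ)‖ = ρ := by
      rw [Complex.norm_real, Real.norm_of_nonneg (hr0.trans hrρ).le]
    refine sum_norm_sq_toeplitz_le_of_summable (summable_norm_pow_smul_of_summable
      (hC ρ (hρ.trans_lt hρ1)).summable (by rwa [hr, hρ])) (fun ζ hζ => ?_) f N
    have hz : ‖ζ * r‖ < 1 := by rwa [norm_mul, hζ, one_mul, hr]
    simp only [smul_smul, ← mul_pow]
    rw [(hC _ hz).tsum_eq]
    exact hΘ _ hz
  have hcont : Continuous fun r : ℝ =>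
      ∑ n ∈ Finset.range N, ‖toeplitz (fun k => (r : ℂ) ^ k • C k) f n‖ ^ 2 := by
    simp only [toeplitz_apply, smul_apply]
    fun_prop
  have hlim := (hcont.tendsto 1).mono_left (nhdsWithin_le_nhds (s := Set.Iio 1))
  simp only [Complex.ofReal_one, one_pow, one_smul] at hlim
  refine le_of_tendsto hlim ?_
  filter_upwards [Ioo_mem_nhdsLT (zero_lt_one' ℝ)] with r hr
  exact hdilate r hr.1 hr.2

theorem IsContractiveAnalytic.exists_coeff {E : Type*} [NormedAddCommGroup E]
    [InnerProductSpace ℂ E] [CompleteSpace E] {Θ : ℂ → E →L[ℂ] E} (hΘ : IsContractiveAnalytic Θ) :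
    ∃ C : ℕ → E →L[ℂ] E, ∀ z : ℂ, ‖z‖ < 1 → HasSum (fun n => z ^ n • C n) (Θ z) := by
  refine ⟨fun n => (n.factorial : ℂ)⁻¹ • iteratedDeriv n Θ 0, fun z hz => ?_⟩
  have h := Complex.hasSum_taylorSeries_on_ball hΘ.analytic.differentiableOn
    (mem_ball_zero_iff.2 hz)
  simp only [sub_zero] at h
  exact h.congr_fun fun n => smul_comm _ _ _

end Toeplitz

/-- The Hilbert space `ℓ²(F)` of square summable sequences in `F`. -/
abbrev SeqSpace (F : Type*) [NormedAddCommGroup F] : Type _ := lp (fun _ : ℕ => F) 2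

namespace SeqSpace

variable {F : Type*} [NormedAddCommGroup F]

theorem hasSum_norm_sq (x : SeqSpace F) : HasSum (fun n => ‖x n‖ ^ 2) (‖x‖ ^ 2) := by
  simpa using lp.hasSum_norm (p := 2) (by simp) x

theorem sum_norm_sq_le (x : SeqSpace F) (N : ℕ) :
    ∑ n ∈ Finset.range N, ‖x n‖ ^ 2 ≤ ‖x‖ ^ 2 :=
  sum_le_hasSum _ (fun _ _ => sq_nonneg _) x.hasSum_norm_sq

theorem norm_le_of_sum_norm_sq_le {x : SeqSpace F} {B : ℝ} (hB : 0 ≤ B)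
    (h : ∀ N, ∑ n ∈ Finset.range N, ‖x n‖ ^ 2 ≤ B ^ 2) : ‖x‖ ≤ B :=
  le_of_sq_le_sq (le_of_tendsto' x.hasSum_norm_sq.tendsto_sum_nat h) hB

theorem memℓp_of_sum_norm_sq_le {f : ℕ → F} {B : ℝ}
    (h : ∀ N, ∑ n ∈ Finset.range N, ‖f n‖ ^ 2 ≤ B) : Memℓp f 2 := by
  refine memℓp_gen ?_
  simpa using summable_of_sum_range_le (fun n => sq_nonneg ‖f n‖) h

theorem norm_sq_eq_zero_add (x : SeqSpace F) :
    ‖x‖ ^ 2 = ‖x 0‖ ^ 2 + ∑' n, ‖x (n + 1)‖ ^ 2 := by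
  rw [← x.hasSum_norm_sq.tsum_eq, x.hasSum_norm_sq.summable.tsum_eq_zero_add]

variable [InnerProductSpace ℂ F] {F' : Type*} [NormedAddCommGroup F'] [InnerProductSpace ℂ F']

/-- The contraction of `ℓ²` spaces defined by a linear map of sequences that does not increase the
square sums of initial segments. -/
def mapOfCausal (T : (ℕ → F) →ₗ[ℂ] (ℕ → F'))
    (hT : ∀ f N, ∑ n ∈ Finset.range N, ‖T f n‖ ^ 2 ≤ ∑ n ∈ Finset.range N, ‖f n‖ ^ 2) :
    SeqSpace F →L[ℂ] SeqSpace F' :=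
  LinearMap.mkContinuous
    { toFun := fun x => ⟨T x, memℓp_of_sum_norm_sq_le fun N => (hT x N).trans (x.sum_norm_sq_le N)⟩
      map_add' := fun _ _ => Subtype.ext (map_add T _ _)
      map_smul' := fun _ _ => Subtype.ext (map_smul T _ _) } 1 fun x =>
    (norm_le_of_sum_norm_sq_le (norm_nonneg x) fun N =>
      (hT x N).trans (x.sum_norm_sq_le N)).trans_eq (one_mul _).symm

theorem norm_mapOfCausal_apply_le (T : (ℕ → F) →ₗ[ℂ] (ℕ → F')) (hT) (x : SeqSpace F) :
    ‖mapOfCausal T hT x‖ ≤ ‖x‖ :=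
  norm_le_of_sum_norm_sq_le (norm_nonneg x) fun N => (hT x N).trans (x.sum_norm_sq_le N)

/-- The shift `(x₀, x₁, …) ↦ (0, x₀, x₁, …)` of arbitrary sequences. -/
def sequenceShift (F : Type*) [AddCommGroup F] [Module ℂ F] : (ℕ → F) →ₗ[ℂ] (ℕ → F) where
  toFun f n := Nat.casesOn n 0 f
  map_add' f g := by
    funext n
    cases n <;> simp
  map_smul' c f := by
    funext n
    cases n <;> simp

theorem sum_norm_sq_sequenceShift_le (f : ℕ → F) (N : ℕ) :
    ∑ n ∈ Finset.range N, ‖sequenceShift F f n‖ ^ 2 ≤ ∑ n ∈ Finset.range N, ‖f n‖ ^ 2 := by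
  cases N with
  | zero => simp
  | succ N =>
    rw [Finset.sum_range_succ', Finset.sum_range_succ]
    simp [sequenceShift]

/-- The unilateral shift on `ℓ²(F)`. -/
def shift (F : Type*) [NormedAddCommGroup F] [InnerProductSpace ℂ F] :
    SeqSpace F →ₗᵢ[ℂ] SeqSpace F where
  toLinearMap := (mapOfCausal (sequenceShift F) sum_norm_sq_sequenceShift_le).toLinearMap
  norm_map' x := by
    refine (sq_eq_sq₀ (norm_nonneg _) (norm_nonneg _)).1 ?_
    rw [norm_sq_eq_zero_add, ← x.hasSum_norm_sq.tsum_eq]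
    simp [mapOfCausal, sequenceShift]

@[simp]
theorem shift_apply_zero (x : SeqSpace F) : shift F x 0 = 0 := rfl

@[simp]
theorem shift_apply_succ (x : SeqSpace F) (n : ℕ) : shift F x (n + 1) = x n := rfl

theorem norm_sq_single_add_shift (g : F) (x : SeqSpace F) :
    ‖lp.single (E := fun _ : ℕ => F) 2 0 g + shift F x‖ ^ 2 = ‖g‖ ^ 2 + ‖x‖ ^ 2 := by
  rw [norm_sq_eq_zero_add]
  simp [x.hasSum_norm_sq.tsum_eq]

theorem shift_single (k : ℕ) (e : F) : shift F (lp.single 2 k e) = lp.single 2 (k + 1) e := by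
  ext n
  cases n with
  | zero => simp
  | succ n => simp [Pi.single_apply]

theorem iterate_shift_single (k : ℕ) (e : F) :
    (shift F)^[k] (lp.single 2 0 e) = lp.single 2 k e := by
  induction k with
  | zero => rfl
  | succ k ih => rw [Function.iterate_succ_apply', ih, shift_single]

theorem single_mem_wanderingSpace (e : F) : lp.single 2 0 e ∈ wanderingSpace (shift F) :=
  mem_defectSpace_iff.2 fun x => by
    rw [lp.inner_single_right]
    exact inner_zero_left e

theorem single_eq_of_mem_wanderingSpace {y : SeqSpace F} (hy : y ∈ wanderingSpace (shift F)) :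
    lp.single 2 0 (y 0) = y := by
  ext n
  cases n with
  | zero => simp
  | succ n =>
    have h : ⟪shift F (lp.single 2 n (y (n + 1))), y⟫_ℂ = 0 := mem_defectSpace_iff.1 hy _
    rw [shift_single, lp.inner_single_left] at h
    simp [inner_self_eq_zero.1 h]

/-- The identification of `F` with the wandering subspace of the shift on `ℓ²(F)`. -/
def wanderingEquiv (F : Type*) [NormedAddCommGroup F] [InnerProductSpace ℂ F] :
    F ≃ₗᵢ[ℂ] wanderingSpace (shift F) :=
  .ofSurjective
    { toLinearMap := (lp.lsingle (E := fun _ : ℕ => F) 2 0).codRestrict _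
        single_mem_wanderingSpace
      norm_map' := fun e => lp.norm_single (E := fun _ : ℕ => F) two_pos 0 e }
    fun y => ⟨_, Subtype.ext (single_eq_of_mem_wanderingSpace y.2)⟩

@[simp]
theorem coe_wanderingEquiv (e : F) : (wanderingEquiv F e : SeqSpace F) = lp.single 2 0 e := rfl

/-- The diagonal operator on `ℓ²(F)` with all entries equal to `u`. -/
def diagonal (u : F →ₗᵢ[ℂ] F) : SeqSpace F →ₗᵢ[ℂ] SeqSpace F where
  toLinearMap := (mapOfCausal (LinearMap.pi fun n => u.toLinearMap ∘ₗ LinearMap.proj n)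
    fun f N => by simp).toLinearMap
  norm_map' x := by
    refine (sq_eq_sq₀ (norm_nonneg _) (norm_nonneg _)).1 ?_
    rw [← (hasSum_norm_sq x).tsum_eq, ← (hasSum_norm_sq _).tsum_eq]
    exact tsum_congr fun n => congrArg (· ^ 2) (u.norm_map (x n))

@[simp]
theorem diagonal_apply (u : F →ₗᵢ[ℂ] F) (x : SeqSpace F) (n : ℕ) :
    diagonal u x n = u (x n) := rfl

theorem wanderingSpace_diagonal (u : F ≃ₗᵢ[ℂ] F) :
    wanderingSpace (diagonal u.toLinearIsometry) = ⊥ := by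
  refine (Submodule.eq_bot_iff _).2 fun y hy => ?_
  have hsurj : diagonal u.toLinearIsometry (diagonal u.symm.toLinearIsometry y) = y := by
    ext n
    simp
  refine inner_self_eq_zero (𝕜 := ℂ).1 ?_
  nth_rw 1 [← hsurj]
  exact mem_defectSpace_iff.1 hy _

end SeqSpace

section ToeplitzModel

variable {F : Type*} [NormedAddCommGroup F] [InnerProductSpace ℂ F]

theorem toeplitz_sequenceShift (C : ℕ → F →L[ℂ] F) (f : ℕ → F) :
    toeplitz C (SeqSpace.sequenceShift F f) = SeqSpace.sequenceShift F (toeplitz C f) := by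
  funext n
  cases n with
  | zero => simp [toeplitz_apply, SeqSpace.sequenceShift]
  | succ n => simp [toeplitz_apply, SeqSpace.sequenceShift, Finset.Nat.sum_antidiagonal_succ']

theorem toeplitz_single (C : ℕ → F →L[ℂ] F) (e : F) (n : ℕ) :
    toeplitz C (Pi.single 0 e) n = C n e := by
  rw [toeplitz_apply, Finset.sum_eq_single_of_mem (n, 0) (by simp), Pi.single_eq_same]
  rintro ⟨i, j⟩ hij hne
  have hj : j ≠ 0 := by
    rintro rfl
    exact hne (congrArg (·, 0) (by simpa using hij))
  rw [Pi.single_eq_of_ne hj, map_zero]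

theorem functionsUnitarilyEquivalent_pairFunction_shift [CompleteSpace F] {Θ : ℂ → F →L[ℂ] F}
    {C : ℕ → F →L[ℂ] F} (hC : ∀ z : ℂ, ‖z‖ < 1 → HasSum (fun n => z ^ n • C n) (Θ z))
    {A : SeqSpace F →L[ℂ] SeqSpace F} (hA : ∀ x n, A x n = toeplitz C x n) :
    FunctionsUnitarilyEquivalent Θ
      (pairFunction (SeqSpace.shift F).toContinuousLinearMap A) := by
  set J := SeqSpace.wanderingEquiv F
  refine ⟨J, fun z hz e => ext_inner_left ℂ fun y => ?_⟩
  obtain ⟨f, rfl⟩ := J.surjective y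
  have hinner : ∀ k, ⟪(SeqSpace.shift F)^[k] (J f : SeqSpace F), A (J e)⟫_ℂ = ⟪f, C k e⟫_ℂ :=
    fun k => by
      rw [SeqSpace.coe_wanderingEquiv, SeqSpace.coe_wanderingEquiv, SeqSpace.iterate_shift_single,
        lp.inner_single_left, hA, lp.coeFn_single, toeplitz_single]
  have hz' := mem_ball_zero_iff.1 hz
  have hpair := hasSum_inner_pairFunction (SeqSpace.shift F) A hz' (J e) (J f)
  have hΘ := (hC z hz').mapL (innerSL ℂ f ∘L ContinuousLinearMap.apply ℂ F e)
  simp only [hinner] at hpair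
  refine (J.inner_map_map f (Θ z e)).trans (HasSum.unique ?_ hpair)
  simpa using hΘ

theorem IsContractiveAnalytic.exists_commuting_contraction [CompleteSpace F] {Θ : ℂ → F →L[ℂ] F}
    (hΘ : IsContractiveAnalytic Θ) :
    ∃ A : SeqSpace F →L[ℂ] SeqSpace F, (∀ x, ‖A x‖ ≤ ‖x‖) ∧
      (∀ x, A (SeqSpace.shift F x) = SeqSpace.shift F (A x)) ∧
      FunctionsUnitarilyEquivalent (pairFunction (SeqSpace.shift F).toContinuousLinearMap A) Θ := by
  obtain ⟨C, hC⟩ := hΘ.exists_coeff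
  have hcausal := sum_norm_sq_toeplitz_le hC fun z hz => hΘ.contractive z (mem_ball_zero_iff.2 hz)
  exact ⟨SeqSpace.mapOfCausal (toeplitz C) hcausal, SeqSpace.norm_mapOfCausal_apply_le _ _,
    fun x => Subtype.ext (toeplitz_sequenceShift C x),
    (functionsUnitarilyEquivalent_pairFunction_shift hC fun _ _ => rfl).symm⟩

end ToeplitzModel

section Defect

variable {H : Type*} [NormedAddCommGroup H] [InnerProductSpace ℂ H] [CompleteSpace H]
  {H' : Type*} [NormedAddCommGroup H'] [InnerProductSpace ℂ H'] [CompleteSpace H']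

/-- The defect operator `(1 - A* A)^{1/2}` of a contraction `A`. -/
def defectOperator (A : H →L[ℂ] H') : H →L[ℂ] H := CFC.sqrt (1 - A† ∘L A)

theorem inner_one_sub_adjoint_comp_self (A : H →L[ℂ] H') (x : H) :
    ⟪(1 - A† ∘L A) x, x⟫_ℂ = ((‖x‖ ^ 2 - ‖A x‖ ^ 2 : ℝ) : ℂ) := by
  change ⟪x - (A†) (A x), x⟫_ℂ = _
  rw [inner_sub_left, ContinuousLinearMap.adjoint_inner_left, inner_self_eq_norm_sq_to_K,
    inner_self_eq_norm_sq_to_K]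
  push_cast
  rfl

theorem one_sub_adjoint_comp_self_nonneg {A : H →L[ℂ] H'} (hA : ∀ x, ‖A x‖ ≤ ‖x‖) :
    0 ≤ 1 - A† ∘L A := by
  rw [ContinuousLinearMap.nonneg_iff_isPositive, ContinuousLinearMap.isPositive_iff_complex]
  intro x
  have hpos : 0 ≤ ‖x‖ ^ 2 - ‖A x‖ ^ 2 := sub_nonneg.2 (by gcongr; exact hA x)
  rw [inner_one_sub_adjoint_comp_self]
  exact ⟨congrArg Complex.ofReal (Complex.ofReal_re _), hpos.trans_eq (Complex.ofReal_re _).symm⟩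

theorem norm_sq_add_norm_sq_defectOperator {A : H →L[ℂ] H'} (hA : ∀ x, ‖A x‖ ≤ ‖x‖) (x : H) :
    ‖A x‖ ^ 2 + ‖defectOperator A x‖ ^ 2 = ‖x‖ ^ 2 := by
  have hsymm : (defectOperator A).IsPositive :=
    (ContinuousLinearMap.nonneg_iff_isPositive _).1 (CFC.sqrt_nonneg _)
  have hsq : defectOperator A * defectOperator A = 1 - A† ∘L A :=
    CFC.sqrt_mul_sqrt_self _ (one_sub_adjoint_comp_self_nonneg hA)
  have hinner : ⟪defectOperator A x, defectOperator A x⟫_ℂ = ((‖x‖ ^ 2 - ‖A x‖ ^ 2 : ℝ) : ℂ) := by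
    rw [← inner_one_sub_adjoint_comp_self, ← hsq, ← hsymm.inner_left_eq_inner_right]
    rfl
  rw [inner_self_eq_norm_sq_to_K] at hinner
  have hnorm : ‖defectOperator A x‖ ^ 2 = ‖x‖ ^ 2 - ‖A x‖ ^ 2 := by
    apply RCLike.ofReal_injective (K := ℂ)
    push_cast at hinner ⊢
    exact hinner
  rw [hnorm, add_sub_cancel]

theorem norm_defectOperator_of_commute {V : H →ₗᵢ[ℂ] H} {A : H →L[ℂ] H} (hA : ∀ x, ‖A x‖ ≤ ‖x‖)
    (hAV : ∀ x, A (V x) = V (A x)) (x : H) :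
    ‖defectOperator A (V x)‖ = ‖defectOperator A x‖ := by
  have h := norm_sq_add_norm_sq_defectOperator hA (V x)
  rw [hAV, V.norm_map, V.norm_map, ← norm_sq_add_norm_sq_defectOperator hA x] at h
  exact (sq_eq_sq₀ (norm_nonneg _) (norm_nonneg _)).1 (add_left_cancel h)

end Defect

section UnitaryExtension

variable {R : Type*} [NormedAddCommGroup R] [InnerProductSpace ℂ R] [CompleteSpace R]

theorem exists_isometry_of_norm_eq {X F : Type*} [AddCommGroup X] [Module ℂ X]
    [NormedAddCommGroup F] [InnerProductSpace ℂ F] {D : X →ₗ[ℂ] F} {D' : X →ₗ[ℂ] R}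
    (hD : DenseRange D) (hDD' : ∀ x, ‖D' x‖ = ‖D x‖) :
    ∃ Q : F →ₗᵢ[ℂ] R, ∀ x, Q (D x) = D' x := by
  have hQ : ∀ x, D'.extendOfNorm D (D x) = D' x :=
    LinearMap.extendOfNorm_eq hD ⟨1, fun x => by rw [hDD', one_mul]⟩
  refine ⟨⟨(D'.extendOfNorm D).toLinearMap, fun y => ?_⟩, hQ⟩
  refine hD.induction_on (p := fun y => ‖D'.extendOfNorm D y‖ = ‖y‖) y
    (isClosed_eq (by fun_prop) (by fun_prop)) fun x => ?_
  rw [hQ, hDD']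

theorem norm_isometry_add_sq (Q : R →ₗᵢ[ℂ] R) (a : R) {b : R} (hb : Q†ᵢ b = 0) :
    ‖Q a + b‖ ^ 2 = ‖a‖ ^ 2 + ‖b‖ ^ 2 := by
  have hab : ⟪Q a, b⟫_ℂ = 0 :=
    mem_defectSpace_iff.1 (mem_defectSpace_iff_adjoint_eq_zero.2 hb) a
  rw [sq, norm_add_sq_eq_norm_sq_add_norm_sq_of_inner_eq_zero _ _ hab, Q.norm_map, sq, sq]

theorem adjoint_isometry_sub_apply (Q : R →ₗᵢ[ℂ] R) (b : R) : Q†ᵢ (b - Q (Q†ᵢ b)) = 0 := by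
  rw [map_sub, adjoint_isometry_apply, sub_self]

/-- The unitary operator `(a, b) ↦ (Q a + (1 - Q Q*) b, Q* b)` extending the isometry `Q` to the
double of the space. -/
def unitaryExtension (Q : R →ₗᵢ[ℂ] R) : WithLp 2 (R × R) ≃ₗᵢ[ℂ] WithLp 2 (R × R) :=
  .ofSurjective
    { toFun := fun x => WithLp.toLp 2 (Q x.fst + (x.snd - Q (Q†ᵢ x.snd)), Q†ᵢ x.snd)
      map_add' := fun x y => by
        refine congrArg (WithLp.toLp 2) (Prod.ext ?_ (map_add _ _ _))
        change _ = (Q x.fst + (x.snd - Q (Q†ᵢ x.snd))) + (Q y.fst + (y.snd - Q (Q†ᵢ y.snd)))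
        simp only [WithLp.add_fst, WithLp.add_snd, map_add]
        abel
      map_smul' := fun c x => by
        refine congrArg (WithLp.toLp 2) (Prod.ext ?_ (map_smul _ _ _))
        simp [smul_add, smul_sub]
      norm_map' := fun x => by
        refine (sq_eq_sq₀ (norm_nonneg _) (norm_nonneg _)).1 ?_
        have hsnd := norm_isometry_add_sq Q (Q†ᵢ x.snd) (adjoint_isometry_sub_apply Q x.snd)
        rw [add_sub_cancel] at hsnd
        rw [WithLp.prod_norm_sq_eq_of_L2 x, hsnd, WithLp.prod_norm_sq_eq_of_L2]
        refine (congrArg (· + _) (norm_isometry_add_sq Q x.fst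
          (adjoint_isometry_sub_apply Q x.snd))).trans ?_
        exact (add_right_comm _ _ _).trans (add_assoc _ _ _) }
    fun y => ⟨WithLp.toLp 2 (Q†ᵢ y.fst, y.fst - Q (Q†ᵢ y.fst) + Q y.snd), by
      refine congrArg (WithLp.toLp 2) (Prod.ext ?_ ?_) <;>
        simp [adjoint_isometry_apply]⟩

theorem unitaryExtension_apply_inl (Q : R →ₗᵢ[ℂ] R) (a : R) :
    unitaryExtension Q (WithLp.toLp 2 (a, 0)) = WithLp.toLp 2 (Q a, 0) := by
  refine congrArg (WithLp.toLp 2) (Prod.ext ?_ (map_zero _))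
  simp

end UnitaryExtension

theorem exists_unitary_defect {H : Type u} [NormedAddCommGroup H] [InnerProductSpace ℂ H]
    [CompleteSpace H] {V : H →ₗᵢ[ℂ] H} {A : H →L[ℂ] H} (hA : ∀ x, ‖A x‖ ≤ ‖x‖)
    (hAV : ∀ x, A (V x) = V (A x)) :
    ∃ (G : Type u) (_ : NormedAddCommGroup G) (_ : InnerProductSpace ℂ G) (_ : CompleteSpace G)
      (U : G ≃ₗᵢ[ℂ] G) (D : H →L[ℂ] G), (∀ x, ‖A x‖ ^ 2 + ‖D x‖ ^ 2 = ‖x‖ ^ 2) ∧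
        ∀ x, U (D x) = D (V x) := by
  let R := (LinearMap.range (defectOperator A : H →ₗ[ℂ] H)).topologicalClosure
  have : CompleteSpace R := (Submodule.isClosed_topologicalClosure _).completeSpace_coe
  let D : H →L[ℂ] R := (defectOperator A).codRestrict R fun x =>
    Submodule.le_topologicalClosure _ ⟨x, rfl⟩
  have hdense : DenseRange D := fun y => by
    rw [closure_subtype, ← Set.range_comp]
    exact y.2
  obtain ⟨Q, hQ⟩ := exists_isometry_of_norm_eq (D := (D : H →ₗ[ℂ] R))
    (D' := D.toLinearMap ∘ₗ V.toLinearMap) hdense (norm_defectOperator_of_commute hA hAV)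
  let ι : R →L[ℂ] WithLp 2 (R × R) :=
    (WithLp.prodContinuousLinearEquiv 2 ℂ R R).symm.toContinuousLinearMap ∘L .inl ℂ R R
  refine ⟨WithLp 2 (R × R), inferInstance, inferInstance, inferInstance, unitaryExtension Q,
    ι ∘L D, fun x => ?_, fun x => ?_⟩
  · have hι : ‖ι (D x)‖ = ‖defectOperator A x‖ := WithLp.norm_toLp_fst 2 R R (D x)
    rw [ContinuousLinearMap.comp_apply, hι, norm_sq_add_norm_sq_defectOperator hA]
  · exact (unitaryExtension_apply_inl Q (D x)).trans (congrArg ι (hQ x))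

namespace BiIsometry

variable {H : Type*} [NormedAddCommGroup H] [InnerProductSpace ℂ H]
  {G : Type*} [NormedAddCommGroup G] [InnerProductSpace ℂ G]

/-- The isometric dilation `(h, r₀, r₁, …) ↦ (A h, D h, r₀, r₁, …)` of a contraction `A` with defect
operator `D`. -/
def isometricDilation (A : H →L[ℂ] H) (D : H →L[ℂ] G)
    (hD : ∀ x, ‖A x‖ ^ 2 + ‖D x‖ ^ 2 = ‖x‖ ^ 2) :
    WithLp 2 (H × SeqSpace G) →ₗᵢ[ℂ] WithLp 2 (H × SeqSpace G) where
  toFun x := WithLp.toLp 2 (A x.fst, lp.single 2 0 (D x.fst) + SeqSpace.shift G x.snd)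
  map_add' x y := by
    refine congrArg (WithLp.toLp 2) (Prod.ext (map_add _ _ _) ?_)
    change _ = (lp.single 2 0 (D x.fst) + SeqSpace.shift G x.snd) +
      (lp.single 2 0 (D y.fst) + SeqSpace.shift G y.snd)
    simp only [WithLp.add_fst, WithLp.add_snd, map_add, lp.single_add]
    abel
  map_smul' c x := by
    refine congrArg (WithLp.toLp 2) (Prod.ext (map_smul _ _ _) ?_)
    simp [lp.single_smul, smul_add]
  norm_map' x := by
    refine (sq_eq_sq₀ (norm_nonneg _) (norm_nonneg _)).1 ?_
    rw [WithLp.prod_norm_sq_eq_of_L2, WithLp.prod_norm_sq_eq_of_L2, ← hD x.fst, add_assoc]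
    exact congrArg (_ + ·) (SeqSpace.norm_sq_single_add_shift (D x.fst) x.snd)

variable {V : H →ₗᵢ[ℂ] H} {A : H →L[ℂ] H} {U : G ≃ₗᵢ[ℂ] G} {D : H →L[ℂ] G}

/-- The bi-isometry on `H ⊕ ℓ²(G)` whose second isometry is the dilation of `A` and whose first
isometry extends `V` by a unitary operator. -/
def ofCommutingContraction (hAV : ∀ x, A (V x) = V (A x))
    (hD : ∀ x, ‖A x‖ ^ 2 + ‖D x‖ ^ 2 = ‖x‖ ^ 2) (hUD : ∀ x, U (D x) = D (V x)) :
    BiIsometry (WithLp 2 (H × SeqSpace G)) where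
  W₀ := isometryDirectSum V (SeqSpace.diagonal U.toLinearIsometry)
  W₁ := isometricDilation A D hD
  comm x := by
    refine congrArg (WithLp.toLp 2) (Prod.ext (hAV x.fst).symm ?_)
    change SeqSpace.diagonal U.toLinearIsometry (lp.single 2 0 (D x.fst) + SeqSpace.shift G x.snd) =
      lp.single 2 0 (D (V x.fst)) +
        SeqSpace.shift G (SeqSpace.diagonal U.toLinearIsometry x.snd)
    ext n
    cases n with
    | zero => simp [hUD]
    | succ n => simp

theorem functionsUnitarilyEquivalent_ofCommutingContraction [CompleteSpace H] [CompleteSpace G]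
    (hAV : ∀ x, A (V x) = V (A x)) (hD : ∀ x, ‖A x‖ ^ 2 + ‖D x‖ ^ 2 = ‖x‖ ^ 2)
    (hUD : ∀ x, U (D x) = D (V x)) :
    FunctionsUnitarilyEquivalent (ofCommutingContraction hAV hD hUD).charFunction
      (pairFunction V.toContinuousLinearMap A) := by
  have hmem : ∀ e, e ∈ wanderingSpace (ofCommutingContraction hAV hD hUD).W₀ ↔
      e.fst ∈ wanderingSpace V ∧ e.snd = 0 := fun e => by
    refine mem_wanderingSpace_isometryDirectSum.trans (and_congr_right fun _ => ?_)
    rw [SeqSpace.wanderingSpace_diagonal, Submodule.mem_bot]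
  refine (functionsUnitarilyEquivalent_charFunction _).trans
    (functionsUnitarilyEquivalent_of_intertwine (T := WithLp.fstL 2 ℂ H (SeqSpace G))
      (fun _ => rfl) (fun _ => rfl) (fun e he => ((hmem e).1 he).1) (fun e he => ?_)
      fun e he => ⟨WithLp.toLp 2 (e, 0), (hmem _).2 ⟨he, rfl⟩, rfl⟩)
  refine (sq_eq_sq₀ (norm_nonneg _) (norm_nonneg _)).1 ?_
  rw [WithLp.prod_norm_sq_eq_of_L2 e, ((hmem e).1 he).2, norm_zero, zero_pow two_ne_zero, add_zero]
  rfl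

theorem exists_functionsUnitarilyEquivalent {E : Type w} [NormedAddCommGroup E]
    [InnerProductSpace ℂ E] [CompleteSpace E] {Θ : ℂ → E →L[ℂ] E} (hΘ : IsContractiveAnalytic Θ) :
    ∃ (L : Type w) (_ : NormedAddCommGroup L) (_ : InnerProductSpace ℂ L) (_ : CompleteSpace L)
      (X : BiIsometry L), FunctionsUnitarilyEquivalent X.charFunction Θ := by
  obtain ⟨A, hA, hAV, hequiv⟩ := hΘ.exists_commuting_contraction
  obtain ⟨G, _, _, _, U, D, hD, hUD⟩ := exists_unitary_defect hA hAV
  exact ⟨WithLp 2 (SeqSpace E × SeqSpace G), inferInstance, inferInstance, inferInstance, _,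
    (functionsUnitarilyEquivalent_ofCommutingContraction hAV hD hUD).trans hequiv⟩

theorem exists_isZeroPure_functionsUnitarilyEquivalent {E : Type w} [NormedAddCommGroup E]
    [InnerProductSpace ℂ E] [CompleteSpace E] {Θ : ℂ → E →L[ℂ] E} (hΘ : IsContractiveAnalytic Θ) :
    ∃ (L : Type w) (_ : NormedAddCommGroup L) (_ : InnerProductSpace ℂ L) (_ : CompleteSpace L)
      (X : BiIsometry L), X.IsZeroPure ∧ FunctionsUnitarilyEquivalent X.charFunction Θ := by
  obtain ⟨L, _, _, _, X, hX⟩ := exists_functionsUnitarilyEquivalent hΘ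
  have : CompleteSpace X.pureSpace := X.isReducing_pureSpace.isClosed.completeSpace_coe
  exact ⟨X.pureSpace, inferInstance, inferInstance, inferInstance,
    X.restrict X.isReducing_pureSpace, X.isZeroPure_restrict_pureSpace,
    (X.functionsUnitarilyEquivalent_restrict _ X.shiftSpace_le_pureSpace).trans hX⟩

end BiIsometry

end

theorem corollary5p1
    {K : Type u} [NormedAddCommGroup K] [InnerProductSpace ℂ K] [CompleteSpace K]
    {K' : Type v} [NormedAddCommGroup K'] [InnerProductSpace ℂ K'] [CompleteSpace K']
    (W : BiIsometry K) (W' : BiIsometry K') :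
    -- (1) additivity, under the natural identification `J` of the sum of the two spaces `𝔈`
    -- with the space `𝔈` of the direct sum
    (∃ J : WithLp 2 (W.charSpace × W'.charSpace) ≃ₗᵢ[ℂ] (W.directSum W').charSpace,
      (∀ x, (((J x : (W.directSum W').shiftSpace)) : WithLp 2 (K × K')) =
        WithLp.toLp 2 (((x.fst : W.shiftSpace) : K), ((x.snd : W'.shiftSpace) : K'))) ∧
      ∀ z ∈ Metric.ball (0 : ℂ) 1, ∀ x,
        (W.directSum W').charFunction z (J x) =
          J (WithLp.toLp 2 (W.charFunction z x.fst, W'.charFunction z x.snd))) ∧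
    -- (2) unitary invariance
    (W.UnitarilyEquivalent W' →
      FunctionsUnitarilyEquivalent W.charFunction W'.charFunction) ∧
    -- (3) completeness of the invariant for pure bi-isometries
    (W.IsZeroPure → W'.IsZeroPure →
      FunctionsUnitarilyEquivalent W.charFunction W'.charFunction →
      W.UnitarilyEquivalent W') ∧
    -- (4) every contractive analytic function is realized
    (∀ (E : Type w) [NormedAddCommGroup E] [InnerProductSpace ℂ E] [CompleteSpace E]
      (Θ : ℂ → E →L[ℂ] E), IsContractiveAnalytic Θ →
      ∃ (L : Type w) (_ : NormedAddCommGroup L) (_ : InnerProductSpace ℂ L)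
        (_ : CompleteSpace L) (X : BiIsometry L),
        X.IsZeroPure ∧ FunctionsUnitarilyEquivalent X.charFunction Θ) := by
  exact
    ⟨⟨W.charSpaceDirectSum W', W.coe_charSpaceDirectSum W', fun _ hz =>
      W.charFunction_directSum W' (mem_ball_zero_iff.1 hz)⟩,
    BiIsometry.UnitarilyEquivalent.functionsUnitarilyEquivalent,
    BiIsometry.IsZeroPure.unitarilyEquivalent,
    fun _ _ _ _ _ => BiIsometry.exists_isZeroPure_functionsUnitarilyEquivalent⟩
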